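/- Let $d\ge 0$ and let $P\subseteq\mathbb R^d$ be a full-dimensional polyhedron (a finite intersection of closed half spaces with non-empty interior, possibly unbounded). Write $h_P(\mathbf v)=-\min_{\mathbf y\in P}\langle\mathbf v,\mathbf y\rangle$ for its support function, and let $\mathcal N(P)$ be its normal fan, i.e. the set of the cones $C_F=\{\mathbf v: h_P(\mathbf v)=-\langle \mathbf v,\mathbf y\rangle\neq\infty\ \text{for all } \mathbf y\in F\}$, $F$ a non-empty face of $P$. Choose one generator for each ray of $\mathcal N(P)$, and let $V$ be the set of these generators. A triangulation of a fan is a finite set of simplicial cones of the same dimension, each contained in a cone of the fan and generated by chosen ray generators of the fan, which cover the support of the fan and meet pairwise in common faces; a triangulation of a polyhedral cone is a triangulation of the fan of its faces. For a simplicial cone $S$ let $V(S)$ be its set of chosen generators and $|\det S|$ the absolute value of the determinant of these generators, with $|\det S|:=0$ if $S$ is not full-dimensional. For a triangulation $\mathcal T$ of $\mathcal N(P)$ and $\mathbf z\in\mathbb R^d$ put $$A_{\mathbf z}(P)=\sum_{S\in\mathcal T}|\det S|\prod_{\mathbf v\in V\setminus V(S)}h_{P-\mathbf z}(\mathbf v),\qquad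 B_{\mathbf z}(P)=\prod_{\mathbf v\in V}h_{P-\mathbf z}(\mathbf v),\qquad h_{P-\mathbf z}(\mathbf v)=h_P(\mathbf v)+\langle\mathbf v,\mathbf z\rangle .$$ The dual volume function of $P$ is the rational function of $\mathbf z$ $$\mathrm{Vol}^\vee_{\mathbf z}(P)=\sum_{S\in\mathcal T}\frac{|\det S|}{\prod_{\mathbf v\in V(S)}h_{P-\mathbf z}(\mathbf v)} .$$ Its value at $\mathbf z$ is the dual volume $\mathrm{Vol}^\vee(P-\mathbf z)$ whenever $P-\mathbf z$ is non-codegenerate, i.e. $\mathbf 0$ is not in the affine span of any facet of $P-\mathbf z$. Let $C(P)=\overline{\{(t,t\mathbf y): t\ge 0,\ \mathbf y\in P\}}\subseteq\mathbb R^{d+1}$ and let $C(P)^*=\{\mathbf w:\langle \mathbf w,\mathbf x\rangle\ge 0 \text{ for all } \mathbf x\in C(P)\}$ be its dual cone. Let $W$ consist of the vectors $(h_P(\mathbf v),\mathbf v)$, $\mathbf v\in V$, together with $(1,\mathbf 0)$ if $(1,\mathbf 0)$ spans an extreme ray of $C(P)^*$. **Theorem.** $W$ contains exactly one generator of each extreme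 ray of $C(P)^*$. For every triangulation $\mathcal T$ of $\mathcal N(P)$ and every triangulation $\mathcal T'$ of $C(P)^*$, with the adjoint polynomial of $C(P)^*$ given by $$\mathrm{adj}_{C(P)^*}(\mathbf x)=\sum_{F\in\mathcal T'}|\det F|\prod_{\mathbf w\in W\setminus V(F)}\langle\mathbf w,\mathbf x\rangle ,$$ one has, with $\bar{\mathbf z}=(1,\mathbf z)$, $$\mathrm{Vol}^\vee_{\mathbf z}(P)=\frac{\mathrm{adj}_{C(P)^*}(\bar{\mathbf z})}{B_{\mathbf z}(P)}\qquad\text{and}\qquad \mathrm{adj}_{C(P)^*}(\bar{\mathbf z})=A_{\mathbf z}(P).$$ The first is an identity of rational functions in $\mathbf z$, and the second an identity of polynomials in $\mathbf z$. The second also holds for every vector $\mathbf z\in\mathbb R^d$; and for every $\mathbf z$ with $P-\mathbf z$ non-codegenerate one has $B_{\mathbf z}(P)\ne 0$ and $\mathrm{Vol}^\vee(P-\mathbf z)=\mathrm{adj}_{C(P)^*}(\bar{\mathbf z})/B_{\mathbf z}(P)$. -/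

import Mathlib

noncomputable section

namespace DualVolume

open scoped Classical in
/-- `|det(S)|` for a finite set `S` of vectors of `ℝⁿ`: the absolute value of the determinant of the
matrix whose rows are the elements of `S`, in any order. It is `0` unless `S` has exactly `n`
elements, so that cones of lower dimension do not contribute to the sums below. -/
def absDet {n : ℕ} (S : Finset (EuclideanSpace ℝ (Fin n))) : ℝ :=
  if h : S.card = n then
    |Matrix.det (Matrix.of fun i j : Fin n =>
      (((S.equivFinOfCardEq h).symm i : EuclideanSpace ℝ (Fin n)) j))|
  else 0

/-- A polyhedron: a non-empty intersection of finitely many closed half spaces. -/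
def IsPolyhedron {n : ℕ} (P : Set (EuclideanSpace ℝ (Fin n))) : Prop :=
  P.Nonempty ∧ ∃ s : Finset (EuclideanSpace ℝ (Fin n) × ℝ),
    P = {x | ∀ p ∈ s, p.2 ≤ inner ℝ p.1 x}

/-- `F` is a (non-empty) face of `P`. -/
def IsFace {n : ℕ} (P F : Set (EuclideanSpace ℝ (Fin n))) : Prop :=
  F.Nonempty ∧ F ⊆ P ∧ ∃ (y : EuclideanSpace ℝ (Fin n)) (b : ℝ),
    (∀ x ∈ F, inner ℝ x y = b) ∧ ∀ x ∈ P \ F, inner ℝ x y < b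

/-- The collection of all faces of `P`; for a polyhedral cone this is a fan with support `P`. -/
def faces {n : ℕ} (P : Set (EuclideanSpace ℝ (Fin n))) : Set (Set (EuclideanSpace ℝ (Fin n))) :=
  {F | IsFace P F}

/-- The support function `h_P(v) = - min_{y ∈ P} ⟨v, y⟩`. (Only used at vectors `v` at which the
minimum exists, that is, where `h_P` is finite.) -/
def supportFn {n : ℕ} (P : Set (EuclideanSpace ℝ (Fin n))) (v : EuclideanSpace ℝ (Fin n)) : ℝ :=
  -sInf ((fun y => inner ℝ v y) '' P)

/-- The normal cone `C_F = {v | h_P(v) = - ⟨v, y⟩ ≠ ∞ for every y ∈ F}`: the vectors `v` for which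
`⟨v, ·⟩` attains its minimum over `P` at every point of `F`. -/
def normalCone {n : ℕ} (P F : Set (EuclideanSpace ℝ (Fin n))) :
    Set (EuclideanSpace ℝ (Fin n)) :=
  {v | ∀ y ∈ F, IsMinOn (fun x => inner ℝ v x) P y}

/-- The normal fan of `P`. -/
def normalFan {n : ℕ} (P : Set (EuclideanSpace ℝ (Fin n))) :
    Set (Set (EuclideanSpace ℝ (Fin n))) :=
  {K | ∃ F, IsFace P F ∧ K = normalCone P F}

/-- The set of all non-negative linear combinations of elements of `S`. -/
def coneOf {n : ℕ} (S : Set (EuclideanSpace ℝ (Fin n))) : Set (EuclideanSpace ℝ (Fin n)) :=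
  (PointedCone.hull ℝ S : Set (EuclideanSpace ℝ (Fin n)))

/-- `V` consists of exactly one generator for each ray of the fan `𝓕`. -/
def IsRayGenerators {n : ℕ} (𝓕 : Set (Set (EuclideanSpace ℝ (Fin n))))
    (V : Finset (EuclideanSpace ℝ (Fin n))) : Prop :=
  (∀ v ∈ V, v ≠ 0 ∧ coneOf {v} ∈ 𝓕) ∧
    ∀ w : EuclideanSpace ℝ (Fin n), w ≠ 0 → coneOf {w} ∈ 𝓕 →
      ∃! v, v ∈ V ∧ coneOf {v} = coneOf {w}

/-- `T` is a triangulation of the fan `𝓕` into simplicial cones of the same dimension, whose rays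
are rays of `𝓕`; a simplicial cone is recorded by the set of its generators, taken from the system
`V` of ray generators of `𝓕`. Each simplicial cone lies in a cone of `𝓕`, they cover the support of
`𝓕`, and the intersection of any two is a face of both. -/
structure IsTriangulation {n : ℕ} (𝓕 : Set (Set (EuclideanSpace ℝ (Fin n))))
    (V : Finset (EuclideanSpace ℝ (Fin n))) (T : Finset (Finset (EuclideanSpace ℝ (Fin n)))) :
    Prop where
  generators : ∀ S ∈ T, S ⊆ V
  simplicial : ∀ S ∈ T, LinearIndepOn ℝ id (S : Set (EuclideanSpace ℝ (Fin n)))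
  same_dim : ∀ S ∈ T, ∀ S' ∈ T, S.card = S'.card
  refines : ∀ S ∈ T, ∃ K ∈ 𝓕, coneOf (S : Set (EuclideanSpace ℝ (Fin n))) ⊆ K
  covers : (⋃ S ∈ T, coneOf (S : Set (EuclideanSpace ℝ (Fin n)))) = ⋃₀ 𝓕
  inter_face : ∀ S ∈ T, ∀ S' ∈ T,
    IsFace (coneOf (S : Set (EuclideanSpace ℝ (Fin n)))) (coneOf S ∩ coneOf S')

/-- The translate `P - z`. -/
def translate {n : ℕ} (P : Set (EuclideanSpace ℝ (Fin n))) (z : EuclideanSpace ℝ (Fin n)) :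
    Set (EuclideanSpace ℝ (Fin n)) :=
  (fun y => y - z) '' P

/-- The origin is not in the affine span of any facet (face of dimension `n - 1`) of `P`. -/
def NonCodegenerate {n : ℕ} (P : Set (EuclideanSpace ℝ (Fin n))) : Prop :=
  ∀ F, IsFace P F → Module.finrank ℝ (vectorSpan ℝ F) + 1 = n → (0 : EuclideanSpace ℝ (Fin n)) ∉
    affineSpan ℝ F

/-- The dual volume `Vol^∨(P) = ∑_{S ∈ T} |det S| / ∏_{v ∈ S} h_P(v)`, computed from the
triangulation `T` of the normal fan of the non-codegenerate polyhedron `P`. -/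
def dualVolume {n : ℕ} (P : Set (EuclideanSpace ℝ (Fin n)))
    (T : Finset (Finset (EuclideanSpace ℝ (Fin n)))) : ℝ :=
  ∑ S ∈ T, absDet S / ∏ v ∈ S, supportFn P v

open scoped Classical in
/-- The numerator `A_z(P)`. -/
def numerator {n : ℕ} (P : Set (EuclideanSpace ℝ (Fin n))) (V : Finset (EuclideanSpace ℝ (Fin n)))
    (T : Finset (Finset (EuclideanSpace ℝ (Fin n)))) (z : EuclideanSpace ℝ (Fin n)) : ℝ :=
  ∑ S ∈ T, absDet S * ∏ v ∈ V \ S, supportFn (translate P z) v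

/-- The denominator `B_z(P)`. -/
def denominator {n : ℕ} (P : Set (EuclideanSpace ℝ (Fin n)))
    (V : Finset (EuclideanSpace ℝ (Fin n))) (z : EuclideanSpace ℝ (Fin n)) : ℝ :=
  ∏ v ∈ V, supportFn (translate P z) v

/-- The linear form `⟨v, z⟩` as a polynomial in the coordinates of `z`. -/
def linForm {n : ℕ} (v : EuclideanSpace ℝ (Fin n)) : MvPolynomial (Fin n) ℝ :=
  ∑ i, MvPolynomial.C (v i) * MvPolynomial.X i

/-- `h_{P - z}(v) = h_P(v) + ⟨v, z⟩` as a polynomial in the coordinates of `z`. -/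
def supportPoly {n : ℕ} (P : Set (EuclideanSpace ℝ (Fin n))) (v : EuclideanSpace ℝ (Fin n)) :
    MvPolynomial (Fin n) ℝ :=
  MvPolynomial.C (supportFn P v) + linForm v

/-- The dual volume function `Vol^∨_z(P) = Vol^∨(P - z)` as a rational function in the coordinates
of `z`, computed from the triangulation `T` of the normal fan of `P`. -/
def dualVolumeFun {n : ℕ} (P : Set (EuclideanSpace ℝ (Fin n)))
    (T : Finset (Finset (EuclideanSpace ℝ (Fin n)))) : FractionRing (MvPolynomial (Fin n) ℝ) :=
  ∑ S ∈ T, algebraMap (MvPolynomial (Fin n) ℝ) _ (MvPolynomial.C (absDet S)) /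
    ∏ v ∈ S, algebraMap (MvPolynomial (Fin n) ℝ) _ (supportPoly P v)

open scoped Classical in
/-- The numerator `A_z(P)` as a polynomial in the coordinates of `z`. -/
def numeratorPoly {n : ℕ} (P : Set (EuclideanSpace ℝ (Fin n)))
    (V : Finset (EuclideanSpace ℝ (Fin n)))
    (T : Finset (Finset (EuclideanSpace ℝ (Fin n)))) : MvPolynomial (Fin n) ℝ :=
  ∑ S ∈ T, MvPolynomial.C (absDet S) * ∏ v ∈ V \ S, supportPoly P v

/-- The denominator `B_z(P)` as a polynomial in the coordinates of `z`. -/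
def denominatorPoly {n : ℕ} (P : Set (EuclideanSpace ℝ (Fin n)))
    (V : Finset (EuclideanSpace ℝ (Fin n))) : MvPolynomial (Fin n) ℝ :=
  ∏ v ∈ V, supportPoly P v

open scoped Classical in
/-- The adjoint polynomial `adj_C(x) = ∑_{F ∈ T} |det F| ∏_{w ∈ W \ F} ⟨w, x⟩` of a cone `C` with
ray generators `W`, computed from the triangulation `T` of `C`. -/
def adjointPoly {n : ℕ} (W : Finset (EuclideanSpace ℝ (Fin n)))
    (T : Finset (Finset (EuclideanSpace ℝ (Fin n)))) : MvPolynomial (Fin n) ℝ :=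
  ∑ F ∈ T, MvPolynomial.C (absDet F) * ∏ w ∈ W \ F, linForm w

/-- The vector `(t, y)` of `ℝ^{d+1}`. -/
def pair {d : ℕ} (t : ℝ) (y : EuclideanSpace ℝ (Fin d)) : EuclideanSpace ℝ (Fin (d + 1)) :=
  WithLp.toLp 2 (Fin.cons t (fun i => y i))

/-- The cone `C(P)`, the closure of `{(t, t y) | t ≥ 0, y ∈ P}`. -/
def coneOver {d : ℕ} (P : Set (EuclideanSpace ℝ (Fin d))) :
    Set (EuclideanSpace ℝ (Fin (d + 1))) :=
  closure {x | ∃ t : ℝ, 0 ≤ t ∧ ∃ y ∈ P, x = pair t (t • y)}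

/-- The dual cone `C^* = {v | ⟨v, y⟩ ≥ 0 for all y ∈ C}`. -/
def dualCone {n : ℕ} (C : Set (EuclideanSpace ℝ (Fin n))) : Set (EuclideanSpace ℝ (Fin n)) :=
  {v | ∀ y ∈ C, 0 ≤ inner ℝ v y}

open scoped Classical in
/-- The generators of the extreme rays of `C(P)^*` that are matched to the chosen ray generators `V`
of the normal fan of `P`: the vectors `(h_P(v), v)` for `v ∈ V`, together with `(1, 0)` if the latter
spans an extreme ray of `C(P)^*` (which can only happen for unbounded `P`, or for `d = 0`). -/
def dualGenerators {d : ℕ} (P : Set (EuclideanSpace ℝ (Fin d)))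
    (V : Finset (EuclideanSpace ℝ (Fin d))) : Finset (EuclideanSpace ℝ (Fin (d + 1))) :=
  V.image (fun v => pair (supportFn P v) v) ∪
    if coneOf {pair 1 0} ∈ faces (dualCone (coneOver P)) then {pair 1 0} else ∅

end DualVolume

end

namespace DualVolume

open Set

/-! ### Cones and pairs -/

section Basic

variable {n d : ℕ}

/-! For `z` in the interior of `P`, both sums are values of one integral: that of `exp(-⟨w, (1,
z)⟩)` over `C(P)^*`. On a full-dimensional simplicial cone it is the absolute determinant of the
generators divided by the product of their pairings with `(1, z)` (`lintegral_exp_neg_coneOf`). The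
cones of a triangulation overlap in null sets, so `T'` gives the adjoint side.

On the other hand, `C(P)^*` is the epigraph of `h_P` over the support of the normal fan
(`IsPolyhedron.mem_dualCone_coneOver_iff`). Integrating out the height leaves `exp(-(h_P(u) + ⟨u,
z⟩))` on that support (`lintegral_dualCone_coneOver`). The exponent is linear on each normal cone,
so `T` gives the dual volume side. No relation between the two triangulations is needed.

After clearing denominators, the products over `W` and `V` agree because `(1, 0)` pairs to `1` with
`(1, z)`. The numerators are polynomials that agree on a non-empty open set, hence everywhere.

The extreme rays are matched by exposing functionals `(t, q)`: for `t > 0` the point `q / t` lies in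
`P` and the ray comes from the normal fan, while `t = 0` gives the ray of `(1, 0)`. The denominator
does not vanish in the non-codegenerate case because every ray generator exposes a facet. -/

theorem mem_coneOf_finset {S : Finset (EuclideanSpace ℝ (Fin n))} {x : EuclideanSpace ℝ (Fin n)} :
    x ∈ coneOf (S : Set (EuclideanSpace ℝ (Fin n))) ↔
      ∃ c : EuclideanSpace ℝ (Fin n) → ℝ, (∀ v ∈ S, 0 ≤ c v) ∧ x = ∑ v ∈ S, c v • v := by
  constructor
  · intro hx
    obtain ⟨c, -, hc⟩ := Submodule.mem_span_finset.1 hx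
    exact ⟨fun v => (c v : ℝ), fun v _ => (c v).2, hc.symm⟩
  · rintro ⟨c, hc, rfl⟩
    exact Submodule.sum_mem _ fun v hv =>
      PointedCone.smul_mem _ (hc v hv) (Submodule.subset_span hv)

theorem mem_coneOf_singleton {v x : EuclideanSpace ℝ (Fin n)} :
    x ∈ coneOf {v} ↔ ∃ c : ℝ, 0 ≤ c ∧ x = c • v := by
  have h := mem_coneOf_finset (S := {v}) (x := x)
  rw [Finset.coe_singleton] at h
  rw [h]
  constructor
  · rintro ⟨c, hc, rfl⟩
    exact ⟨c v, hc v (by simp), by simp⟩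
  · rintro ⟨c, hc, rfl⟩
    exact ⟨fun _ => c, fun _ _ => hc, by simp⟩

theorem self_mem_coneOf {S : Set (EuclideanSpace ℝ (Fin n))} {v : EuclideanSpace ℝ (Fin n)}
    (hv : v ∈ S) : v ∈ coneOf S := Submodule.subset_span hv

theorem zero_mem_coneOf (S : Set (EuclideanSpace ℝ (Fin n))) : 0 ∈ coneOf S :=
  Submodule.zero_mem _

theorem coneOf_singleton_eq_iff {v w : EuclideanSpace ℝ (Fin n)} (hw : w ≠ 0) :
    coneOf {v} = coneOf {w} ↔ ∃ c : ℝ, 0 < c ∧ w = c • v := by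
  constructor
  · intro h
    have hw' : w ∈ coneOf {v} := h ▸ self_mem_coneOf (mem_singleton w)
    obtain ⟨c, hc, rfl⟩ := mem_coneOf_singleton.1 hw'
    refine ⟨c, lt_of_le_of_ne hc ?_, rfl⟩
    rintro rfl
    simp at hw
  · rintro ⟨c, hc, rfl⟩
    ext x
    simp only [mem_coneOf_singleton]
    constructor
    · rintro ⟨a, ha, rfl⟩
      refine ⟨a / c, by positivity, ?_⟩
      rw [smul_smul]
      congr 1
      field_simp
    · rintro ⟨a, ha, rfl⟩
      exact ⟨a * c, by positivity, by rw [smul_smul]⟩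

@[simp] theorem pair_zero (t : ℝ) (y : EuclideanSpace ℝ (Fin d)) : pair t y 0 = t := rfl

@[simp] theorem pair_succ (t : ℝ) (y : EuclideanSpace ℝ (Fin d)) (i : Fin d) :
    pair t y i.succ = y i := rfl

theorem inner_pair (a t : ℝ) (u y : EuclideanSpace ℝ (Fin d)) :
    inner ℝ (pair a u) (pair t y) = a * t + inner ℝ u y := by
  simp [PiLp.inner_apply, Fin.sum_univ_succ, mul_comm]

theorem exists_eq_pair (w : EuclideanSpace ℝ (Fin (d + 1))) : ∃ a u, w = pair a u := by
  refine ⟨w 0, WithLp.toLp 2 fun i => w i.succ, ?_⟩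
  ext i
  refine Fin.cases ?_ (fun i => ?_) i <;> simp

theorem pair_inj {a b : ℝ} {u v : EuclideanSpace ℝ (Fin d)} :
    pair a u = pair b v ↔ a = b ∧ u = v := by
  constructor
  · intro h
    refine ⟨by simpa using congrArg (fun w => w 0) h, ?_⟩
    ext i
    simpa using congrArg (fun w => w i.succ) h
  · rintro ⟨rfl, rfl⟩
    rfl

theorem smul_pair (c a : ℝ) (u : EuclideanSpace ℝ (Fin d)) :
    c • pair a u = pair (c * a) (c • u) := by
  ext i
  refine Fin.cases ?_ (fun i => ?_) i <;> simp

theorem pair_eq_zero {a : ℝ} {u : EuclideanSpace ℝ (Fin d)} : pair a u = 0 ↔ a = 0 ∧ u = 0 := by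
  have h : (0 : EuclideanSpace ℝ (Fin (d + 1))) = pair 0 0 := by
    simpa using smul_pair (0 : ℝ) 0 (0 : EuclideanSpace ℝ (Fin d))
  rw [h, pair_inj]

end Basic

/-! ### Polyhedra -/

section Polyhedron

variable {d : ℕ} {P : Set (EuclideanSpace ℝ (Fin d))}

theorem IsPolyhedron.convex (hP : IsPolyhedron P) : Convex ℝ P := by
  obtain ⟨-, s, rfl⟩ := hP
  have : {x : EuclideanSpace ℝ (Fin d) | ∀ p ∈ s, p.2 ≤ inner ℝ p.1 x} =
      ⋂ p ∈ s, {x | p.2 ≤ inner ℝ p.1 x} := by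
    ext; simp
  rw [this]
  exact convex_iInter₂ fun p _ => convex_halfSpace_ge (innerSL ℝ p.1).isLinear p.2

/-- Moving inside a polyhedron so that the constraint normals active at the point span `u`. -/
theorem exists_mem_span_active (s : Finset (EuclideanSpace ℝ (Fin d) × ℝ))
    (u : EuclideanSpace ℝ (Fin d)) (m : ℝ)
    (hm : ∀ x, (∀ p ∈ s, p.2 ≤ inner ℝ p.1 x) → m ≤ inner ℝ u x)
    (x : EuclideanSpace ℝ (Fin d)) (hx : ∀ p ∈ s, p.2 ≤ inner ℝ p.1 x) :
    ∃ y, (∀ p ∈ s, p.2 ≤ inner ℝ p.1 y) ∧ inner ℝ u y ≤ inner ℝ u x ∧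
      u ∈ Submodule.span ℝ (Prod.fst '' {p | p ∈ s ∧ inner ℝ p.1 y = p.2}) := by
  classical
  induction hk : (s.filter fun p => inner ℝ p.1 x ≠ p.2).card using Nat.strong_induction_on
    generalizing x with
  | _ k ih =>
  set A := Submodule.span ℝ (Prod.fst '' {p | p ∈ s ∧ inner ℝ p.1 x = p.2})
  by_cases hu : u ∈ A
  · exact ⟨x, hx, le_rfl, hu⟩
  -- The direction is minus the component of `u` orthogonal to the active normals: it keeps active
  -- constraints tight and strictly decreases `u`.
  obtain ⟨w, hwA, hwu⟩ : ∃ w ∈ Aᗮ, inner ℝ u w < 0 := by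
    refine ⟨-(u - A.starProjection u),
      Submodule.neg_mem _ (A.sub_starProjection_mem_orthogonal u), ?_⟩
    have h1 : u - A.starProjection u ≠ 0 := fun h => hu (by
      rw [sub_eq_zero.1 h]; exact A.starProjection_apply_mem u)
    have h2 : inner ℝ (A.starProjection u) (u - A.starProjection u) = 0 :=
      A.sub_starProjection_mem_orthogonal u _ (A.starProjection_apply_mem u)
    have h3 : inner ℝ u (u - A.starProjection u) =
        inner ℝ (u - A.starProjection u) (u - A.starProjection u) := by
      rw [inner_sub_left (𝕜 := ℝ) u, h2, sub_zero]
    rw [inner_neg_right, h3, neg_lt_zero]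
    exact real_inner_self_pos.2 h1
  have hact : ∀ p ∈ s, inner ℝ p.1 x = p.2 → inner ℝ p.1 w = 0 := fun p hp h =>
    hwA p.1 (Submodule.subset_span ⟨p, ⟨hp, h⟩, rfl⟩)
  set N := s.filter fun p => inner ℝ p.1 w < 0
  have hNne : N.Nonempty := by
    by_contra hne
    rw [Finset.not_nonempty_iff_eq_empty, Finset.filter_eq_empty_iff] at hne
    push Not at hne
    have hle := hm x hx
    -- If no constraint blocks the ray along `w`, this step length brings `u` down to `m - 1`, below
    -- its lower bound.
    have := hm (x + ((inner ℝ u x - m + 1) / -inner ℝ u w) • w) (fun p hp => by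
      rw [inner_add_right, inner_smul_right]
      have h1 : 0 ≤ (inner ℝ u x - m + 1) / -inner ℝ u w :=
        div_nonneg (by linarith) (by linarith)
      have := mul_nonneg h1 (hne hp)
      linarith [hx p hp])
    rw [inner_add_right, inner_smul_right, div_mul_eq_mul_div, div_neg,
      mul_div_assoc, div_self hwu.ne] at this
    linarith
  -- Ratio test: `q` is a constraint that becomes tight first, so the number of inactive constraints
  -- drops.
  obtain ⟨q, hq, hqmin⟩ := N.exists_min_image (fun p => (inner ℝ p.1 x - p.2) / -inner ℝ p.1 w) hNne
  set t := (inner ℝ q.1 x - q.2) / -inner ℝ q.1 w with ht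
  obtain ⟨hqs, hqw⟩ := Finset.mem_filter.1 hq
  have ht0 : 0 ≤ t := div_nonneg (by linarith [hx q hqs]) (by linarith)
  have hy : ∀ p ∈ s, p.2 ≤ inner ℝ p.1 (x + t • w) := by
    intro p hp
    rw [inner_add_right, inner_smul_right]
    by_cases hpw : inner ℝ p.1 w < 0
    · have h1 := hqmin p (Finset.mem_filter.2 ⟨hp, hpw⟩)
      rw [le_div_iff₀ (by linarith)] at h1
      linarith
    · have := mul_nonneg ht0 (not_lt.1 hpw)
      linarith [hx p hp]
  have hqy : inner ℝ q.1 (x + t • w) = q.2 := by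
    rw [inner_add_right, inner_smul_right, ht]
    have : inner ℝ q.1 w ≠ 0 := hqw.ne
    field_simp
    ring
  have hlt : (s.filter fun p => inner ℝ p.1 (x + t • w) ≠ p.2).card < k := by
    rw [← hk]
    apply Finset.card_lt_card
    rw [Finset.ssubset_iff_of_subset]
    · refine ⟨q, Finset.mem_filter.2 ⟨hqs, fun h => hqw.ne (hact q hqs h)⟩, ?_⟩
      simp [hqy]
    · intro p hp
      obtain ⟨hps, hpn⟩ := Finset.mem_filter.1 hp
      refine Finset.mem_filter.2 ⟨hps, fun h => hpn ?_⟩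
      rw [inner_add_right, inner_smul_right, hact p hps h, h]
      ring
  obtain ⟨y, hy1, hy2, hy3⟩ := ih _ hlt (x + t • w) hy rfl
  refine ⟨y, hy1, hy2.trans ?_, hy3⟩
  rw [inner_add_right, inner_smul_right]
  linarith [mul_nonneg ht0 (neg_nonneg.2 hwu.le)]

/-- A linear form which is bounded below on a polyhedron attains its minimum. -/
theorem IsPolyhedron.exists_isMinOn (hP : IsPolyhedron P) {u : EuclideanSpace ℝ (Fin d)} {m : ℝ}
    (hm : ∀ y ∈ P, m ≤ inner ℝ u y) : ∃ y ∈ P, IsMinOn (fun x => inner ℝ u x) P y := by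
  classical
  obtain ⟨⟨x₀, hx₀⟩, s, rfl⟩ := hP
  let Q := {y : EuclideanSpace ℝ (Fin d) | (∀ p ∈ s, p.2 ≤ inner ℝ p.1 y) ∧
    u ∈ Submodule.span ℝ (Prod.fst '' {p | p ∈ s ∧ inner ℝ p.1 y = p.2})}
  have hred := exists_mem_span_active s u m hm
  -- the value of `u` at such a point is determined by the set of active constraints
  have hdet : ∀ y ∈ Q, ∀ z ∈ Q, (s.filter fun p => inner ℝ p.1 y = p.2) =
      (s.filter fun p => inner ℝ p.1 z = p.2) → inner ℝ u y = inner ℝ u z := by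
    intro y hy z hz hyz
    have key : ∀ v ∈ Submodule.span ℝ (Prod.fst '' {p | p ∈ s ∧ inner ℝ p.1 y = p.2}),
        inner ℝ v y = inner ℝ v z := by
      intro v hv
      induction hv using Submodule.span_induction with
      | mem v hv =>
        obtain ⟨p, ⟨hp, hpy⟩, rfl⟩ := hv
        have : p ∈ s.filter fun p => inner ℝ p.1 z = p.2 :=
          hyz ▸ Finset.mem_filter.2 ⟨hp, hpy⟩
        rw [hpy, (Finset.mem_filter.1 this).2]
      | zero => simp
      | add v w _ _ hv hw => rw [inner_add_left, inner_add_left, hv, hw]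
      | smul c v _ hv => rw [real_inner_smul_left, real_inner_smul_left, hv]
    exact key u hy.2
  -- The values are indexed by active sets, of which there are finitely many; `0` is a dummy for
  -- subsets that do not occur.
  have hfin : ((fun y => inner ℝ u y) '' Q).Finite := by
    have hsub : ((fun y => inner ℝ u y) '' Q) ⊆ (fun t : Finset (EuclideanSpace ℝ (Fin d) × ℝ) =>
        if h : ∃ y ∈ Q, (s.filter fun p => inner ℝ p.1 y = p.2) = t
          then inner ℝ u h.choose else 0) '' (s.powerset : Set _) := by
      rintro _ ⟨y, hy, rfl⟩
      refine ⟨s.filter fun p => inner ℝ p.1 y = p.2,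
        Finset.mem_coe.2 (Finset.mem_powerset.2 (Finset.filter_subset _ _)), ?_⟩
      have h : ∃ z ∈ Q, (s.filter fun p => inner ℝ p.1 z = p.2) =
        s.filter fun p => inner ℝ p.1 y = p.2 := ⟨y, hy, rfl⟩
      simp only [dif_pos h]
      exact hdet _ h.choose_spec.1 _ hy h.choose_spec.2
    exact (s.powerset.finite_toSet.image _).subset hsub
  have hne : ((fun y => inner ℝ u y) '' Q).Nonempty := by
    obtain ⟨y, hy, -, hy'⟩ := hred x₀ hx₀
    exact ⟨_, y, ⟨hy, hy'⟩, rfl⟩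
  obtain ⟨_, ⟨y, hy, rfl⟩, hmin⟩ := hfin.exists_minimal hne
  refine ⟨y, hy.1, fun x hx => ?_⟩
  obtain ⟨z, hz, hzx, hz'⟩ := hred x hx
  have hzQ : inner ℝ u z ∈ (fun y => inner ℝ u y) '' Q := ⟨z, ⟨hz, hz'⟩, rfl⟩
  show inner ℝ u y ≤ inner ℝ u x
  rcases le_total (inner ℝ u y) (inner ℝ u z) with h | h
  · exact h.trans hzx
  · exact (hmin hzQ h).trans hzx

theorem supportFn_eq_neg_inner {u y : EuclideanSpace ℝ (Fin d)} (hy : y ∈ P)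
    (h : IsMinOn (fun x => inner ℝ u x) P y) : supportFn P u = -inner ℝ u y := by
  have : IsLeast ((fun x => inner ℝ u x) '' P) (inner ℝ u y) :=
    ⟨⟨y, hy, rfl⟩, by rintro _ ⟨x, hx, rfl⟩; exact h hx⟩
  rw [supportFn, this.csInf_eq]

/-- The face of `P` on which the linear form `⟨u, ·⟩` is minimal. -/
def minFace (P : Set (EuclideanSpace ℝ (Fin d))) (u : EuclideanSpace ℝ (Fin d)) :
    Set (EuclideanSpace ℝ (Fin d)) :=
  {y | y ∈ P ∧ IsMinOn (fun x => inner ℝ u x) P y}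

theorem isFace_minFace {u y : EuclideanSpace ℝ (Fin d)} (hy : y ∈ minFace P u) :
    IsFace P (minFace P u) := by
  -- Faces are exposed by maximising a form, normal cones by minimising one; hence the sign.
  refine ⟨⟨y, hy⟩, fun x hx => hx.1, -u, -inner ℝ u y, fun x hx => ?_, fun x hx => ?_⟩
  · rw [inner_neg_right, real_inner_comm]
    exact congrArg Neg.neg (le_antisymm (hx.2 hy.1) (hy.2 hx.1))
  · rw [inner_neg_right, real_inner_comm, neg_lt_neg_iff]
    refine lt_of_le_of_ne (hy.2 hx.1) fun h => hx.2 ⟨hx.1, fun z hz => ?_⟩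
    show inner ℝ u x ≤ inner ℝ u z
    rw [← h]
    exact hy.2 hz

theorem IsFace.convex {F : Set (EuclideanSpace ℝ (Fin d))} (hP : Convex ℝ P) (hF : IsFace P F) :
    Convex ℝ F := by
  obtain ⟨-, hFP, y, b, h1, h2⟩ := hF
  have : F = P ∩ {x | inner ℝ y x = b} := by
    ext x
    refine ⟨fun hx => ⟨hFP hx, ?_⟩, fun hx => ?_⟩
    · rw [mem_ofPred_eq, real_inner_comm]; exact h1 x hx
    · by_contra hxF
      have := h2 x ⟨hx.1, hxF⟩
      rw [real_inner_comm] at this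
      exact this.ne hx.2
  rw [this]
  exact hP.inter (convex_hyperplane (innerSL ℝ y).isLinear b)

/-- A point in the relative interior of a face has the same normal cone as the face. -/
theorem IsFace.exists_normalCone_eq {F : Set (EuclideanSpace ℝ (Fin d))} (hP : Convex ℝ P)
    (hF : IsFace P F) : ∃ y ∈ F, normalCone P {y} = normalCone P F := by
  obtain ⟨y, hy⟩ := hF.1.intrinsicInterior (hF.convex hP)
  have hyF := intrinsicInterior_subset hy
  refine ⟨y, hyF, Subset.antisymm (fun u hu x hx z hz => ?_) fun u hu x hx => ?_⟩
  · have hu' : IsMinOn (fun x => inner ℝ u x) P y := hu y rfl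
    obtain ⟨y', hy', rfl⟩ := mem_intrinsicInterior.1 hy
    let g : ℝ → affineSpan ℝ F := fun t => ⟨AffineMap.lineMap (y' : EuclideanSpace ℝ (Fin d)) x t,
      AffineMap.lineMap_mem t y'.2 (subset_affineSpan ℝ F hx)⟩
    have hg : Continuous g := by
      refine Continuous.subtype_mk ?_ _
      exact AffineMap.lineMap_continuous
    have hg0 : g 0 = y' := by ext1; simp [g]
    have hev : ∀ᶠ t in nhds (0 : ℝ), (g t : EuclideanSpace ℝ (Fin d)) ∈ F := by
      have := hg.continuousAt (x := (0 : ℝ)) (by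
        rw [hg0]; exact mem_interior_iff_mem_nhds.1 hy')
      exact this
    obtain ⟨ε, hε, hball⟩ := Metric.eventually_nhds_iff.1 hev
    -- The segment from `x` to `y'` can be prolonged slightly past `y'` inside `F`. Minimality at
    -- `y'` then forces the form at `x` to be no larger than at `y'`.
    have hmem := hF.2.1 (hball (y := -(ε / 2)) (by
      rw [dist_zero_right, Real.norm_eq_abs, abs_neg, abs_of_pos (by linarith)]; linarith))
    have h1 : inner ℝ u (y' : EuclideanSpace ℝ (Fin d)) ≤ _ := hu' hmem
    have h2 : inner ℝ u (y' : EuclideanSpace ℝ (Fin d)) ≤ inner ℝ u z := hu' hz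
    simp only [g, AffineMap.lineMap_apply_module', inner_add_right, inner_smul_right,
      inner_sub_right] at h1
    show inner ℝ u x ≤ inner ℝ u z
    have : 0 ≤ (-(ε / 2)) * (inner ℝ u x - inner ℝ u (y' : EuclideanSpace ℝ (Fin d))) := by linarith
    nlinarith
  · rw [mem_singleton_iff] at hx
    exact hx ▸ hu y hyF

theorem mem_sUnion_normalFan {u : EuclideanSpace ℝ (Fin d)} :
    u ∈ ⋃₀ normalFan P ↔ ∃ y ∈ P, IsMinOn (fun x => inner ℝ u x) P y := by
  constructor
  · rintro ⟨_, ⟨F, hF, rfl⟩, hu⟩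
    obtain ⟨y, hy⟩ := hF.1
    exact ⟨y, hF.2.1 hy, hu y hy⟩
  · rintro ⟨y, hy, h⟩
    exact ⟨_, ⟨_, isFace_minFace (u := u) ⟨hy, h⟩, rfl⟩, fun x hx => hx.2⟩

/-! ### The dual cone as the epigraph of the support function -/

theorem mem_dualCone_coneOver {a : ℝ} {u : EuclideanSpace ℝ (Fin d)} :
    pair a u ∈ dualCone (coneOver P) ↔ ∀ y ∈ P, -a ≤ inner ℝ u y := by
  constructor
  · intro h y hy
    have := h (pair 1 y) (subset_closure ⟨1, zero_le_one, y, hy, by rw [one_smul]⟩)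
    rw [inner_pair] at this
    linarith
  · intro h x hx
    refine closure_minimal (t := {x | 0 ≤ inner ℝ (pair a u) x}) ?_ ?_ hx
    · rintro _ ⟨t, ht, y, hy, rfl⟩
      rw [mem_ofPred_eq, inner_pair, inner_smul_right]
      nlinarith [h y hy, mul_nonneg ht (by linarith [h y hy] : 0 ≤ a + inner ℝ u y)]
    · exact isClosed_le continuous_const (by fun_prop)

/-- A form bounded below on a polyhedron attains its minimum, so membership in the dual cone already
puts `u` in the support of the normal fan. -/
theorem IsPolyhedron.mem_dualCone_coneOver_iff (hP : IsPolyhedron P) {a : ℝ}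
    {u : EuclideanSpace ℝ (Fin d)} :
    pair a u ∈ dualCone (coneOver P) ↔ u ∈ ⋃₀ normalFan P ∧ supportFn P u ≤ a := by
  rw [mem_dualCone_coneOver, mem_sUnion_normalFan]
  constructor
  · intro h
    obtain ⟨y, hy, hmin⟩ := hP.exists_isMinOn h
    refine ⟨⟨y, hy, hmin⟩, ?_⟩
    rw [supportFn_eq_neg_inner hy hmin]
    linarith [h y hy]
  · rintro ⟨⟨y, hy, hmin⟩, h⟩ x hx
    rw [supportFn_eq_neg_inner hy hmin] at h
    have : inner ℝ u y ≤ inner ℝ u x := hmin hx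
    linarith

end Polyhedron

end DualVolume

namespace DualVolume

open Set

/-! ### Ray generators -/

section Rays

variable {d : ℕ} {P : Set (EuclideanSpace ℝ (Fin d))} {V : Finset (EuclideanSpace ℝ (Fin d))}

theorem IsRayGenerators.eq_of_coneOf_eq {𝓕 : Set (Set (EuclideanSpace ℝ (Fin d)))}
    (hV : IsRayGenerators 𝓕 V) {v w : EuclideanSpace ℝ (Fin d)} (hv : v ∈ V) (hw : w ∈ V)
    (h : coneOf {v} = coneOf {w}) : v = w :=
  (hV.2 w (hV.1 w hw).1 (hV.1 w hw).2).unique ⟨hv, h⟩ ⟨hw, rfl⟩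

theorem isMinOn_smul {u y : EuclideanSpace ℝ (Fin d)} {c : ℝ} (hc : 0 ≤ c)
    (h : IsMinOn (fun x => inner ℝ u x) P y) : IsMinOn (fun x => inner ℝ (c • u) x) P y := by
  intro x hx
  show inner ℝ (c • u) y ≤ inner ℝ (c • u) x
  rw [real_inner_smul_left, real_inner_smul_left]
  exact mul_le_mul_of_nonneg_left (h hx) hc

theorem IsRayGenerators.exists_normalCone_eq (hP : Convex ℝ P)
    (hV : IsRayGenerators (normalFan P) V) {v : EuclideanSpace ℝ (Fin d)} (hv : v ∈ V) :
    ∃ y ∈ P, normalCone P {y} = coneOf {v} := by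
  obtain ⟨F, hF, hvF⟩ := (hV.1 v hv).2
  obtain ⟨y, hy, hyF⟩ := hF.exists_normalCone_eq hP
  exact ⟨y, hF.2.1 hy, hyF.trans hvF.symm⟩

theorem isMinOn_of_normalCone_eq {v y : EuclideanSpace ℝ (Fin d)}
    (h : normalCone P {y} = coneOf {v}) : IsMinOn (fun x => inner ℝ v x) P y :=
  (h ▸ self_mem_coneOf (mem_singleton v) : v ∈ normalCone P {y}) y rfl

theorem mem_normalCone_singleton {u y : EuclideanSpace ℝ (Fin d)} :
    u ∈ normalCone P {y} ↔ IsMinOn (fun x => inner ℝ u x) P y := by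
  simp [normalCone]

theorem mem_dualGenerators {w : EuclideanSpace ℝ (Fin (d + 1))} :
    w ∈ dualGenerators P V ↔ (∃ v ∈ V, pair (supportFn P v) v = w) ∨
      (w = pair 1 0 ∧ coneOf {pair 1 0} ∈ faces (dualCone (coneOver P))) := by
  classical
  rw [dualGenerators, Finset.mem_union, Finset.mem_image]
  refine or_congr Iff.rfl ?_
  split_ifs with h <;> simp [h]

/-- Take `y` with normal cone equal to the ray of `v`. On the dual cone `a + ⟨u, y⟩ ≥ 0`, and
equality makes `u` minimal at `y`, hence a multiple of `v`. So `(1, y)` cuts out exactly this ray.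
-/
theorem coneOf_pair_mem_faces (hP : IsPolyhedron P) (hV : IsRayGenerators (normalFan P) V)
    {v : EuclideanSpace ℝ (Fin d)} (hv : v ∈ V) :
    coneOf {pair (supportFn P v) v} ∈ faces (dualCone (coneOver P)) := by
  obtain ⟨y, hy, hyv⟩ := hV.exists_normalCone_eq hP.convex hv
  have hmin := isMinOn_of_normalCone_eq hyv
  rw [supportFn_eq_neg_inner hy hmin]
  refine ⟨⟨0, zero_mem_coneOf _⟩, ?_, -pair 1 y, 0, ?_, ?_⟩
  · intro x hx
    obtain ⟨c, hc, rfl⟩ := mem_coneOf_singleton.1 hx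
    rw [smul_pair, mem_dualCone_coneOver]
    intro z hz
    have := isMinOn_smul hc hmin hz
    simp only [mem_ofPred_eq, real_inner_smul_left] at this ⊢
    linarith
  · intro x hx
    obtain ⟨c, hc, rfl⟩ := mem_coneOf_singleton.1 hx
    rw [inner_neg_right, smul_pair, inner_pair, real_inner_smul_left]
    ring
  · rintro x ⟨hx, hxc⟩
    obtain ⟨a, u, rfl⟩ := exists_eq_pair x
    rw [mem_dualCone_coneOver] at hx
    rw [inner_neg_right, inner_pair]
    by_contra hcon
    have hau : a = -inner ℝ u y := by linarith [hx y hy]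
    have hu : u ∈ normalCone P {y} := by
      rw [mem_normalCone_singleton]
      intro z hz
      show inner ℝ u y ≤ inner ℝ u z
      linarith [hx z hz]
    rw [hyv] at hu
    obtain ⟨c, hc, rfl⟩ := mem_coneOf_singleton.1 hu
    refine hxc (mem_coneOf_singleton.2 ⟨c, hc, ?_⟩)
    rw [smul_pair, hau, real_inner_smul_left, mul_neg]

/-- The ray is the zero set on the dual cone of a nonnegative functional `(t, q)`, and `t ≥ 0` since
`(1, 0)` is in the dual cone. If `t = 0`, then `(1, 0)` is in the ray. If `t > 0`, then `q / t` is a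
point of `P` at which `u` is minimal, and the ray of `u` is a normal cone. -/
theorem exists_dualGenerator (hP : IsPolyhedron P) (hV : IsRayGenerators (normalFan P) V)
    {w : EuclideanSpace ℝ (Fin (d + 1))} (hw0 : w ≠ 0)
    (hw : coneOf {w} ∈ faces (dualCone (coneOver P))) :
    ∃ w' ∈ dualGenerators P V, coneOf {w'} = coneOf {w} := by
  obtain ⟨-, hwC, x, b, hb1, hb2⟩ := id hw
  have hb0 : b = 0 := by rw [← hb1 0 (zero_mem_coneOf _), inner_zero_left]
  subst hb0
  obtain ⟨t, q, hx⟩ := exists_eq_pair (-x)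
  obtain rfl : x = -pair t q := by rw [← hx, neg_neg]
  obtain ⟨a, u, rfl⟩ := exists_eq_pair w
  have hwC' := hwC (self_mem_coneOf (mem_singleton _))
  have hwx := hb1 _ (self_mem_coneOf (mem_singleton _))
  have hface : ∀ a' u', pair a' u' ∈ dualCone (coneOver P) → a' * t + inner ℝ u' q ≤ 0 →
      ∃ c : ℝ, 0 ≤ c ∧ pair a' u' = c • pair a u := by
    intro a' u' h h'
    by_contra hcon
    have := hb2 (pair a' u') ⟨h, fun h => hcon (mem_coneOf_singleton.1 h)⟩
    rw [inner_neg_right, inner_pair] at this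
    linarith
  have hnonneg : ∀ a' u', pair a' u' ∈ dualCone (coneOver P) → 0 ≤ a' * t + inner ℝ u' q := by
    intro a' u' h
    by_contra hcon
    obtain ⟨c, hc, hcw⟩ := hface a' u' h (by linarith)
    have := hb1 (pair a' u') (mem_coneOf_singleton.2 ⟨c, hc, hcw⟩)
    rw [inner_neg_right, inner_pair] at this
    linarith
  have h10 : pair 1 0 ∈ dualCone (coneOver P) := by
    rw [mem_dualCone_coneOver]
    intro y _
    rw [inner_zero_left]
    norm_num
  have ht : 0 ≤ t := by simpa using hnonneg 1 0 h10
  rcases ht.eq_or_lt with rfl | ht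
  · obtain ⟨c, hc, hcw⟩ := hface 1 0 h10 (by simp)
    have hc' : 0 < c := by
      refine lt_of_le_of_ne hc ?_
      rintro rfl
      rw [zero_smul, pair_eq_zero] at hcw
      exact one_ne_zero hcw.1
    have heq : coneOf {pair 1 0} = coneOf {pair a u} :=
      ((coneOf_singleton_eq_iff (by simp [pair_eq_zero])).2 ⟨c, hc', hcw⟩).symm
    exact ⟨pair 1 0, mem_dualGenerators.2 (Or.inr ⟨rfl, heq ▸ hw⟩), heq⟩
  · obtain ⟨y, hqy⟩ : ∃ y, q = t • y := ⟨t⁻¹ • q, (smul_inv_smul₀ ht.ne' q).symm⟩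
    -- Each defining inequality of `P` is itself an element of the dual cone, so nonnegativity of
    -- the functional says that `y` satisfies it.
    have hyP : y ∈ P := by
      obtain ⟨-, s, hs⟩ := hP
      rw [hs]
      intro p hp
      have hpC : pair (-p.2) p.1 ∈ dualCone (coneOver P) := by
        rw [mem_dualCone_coneOver, neg_neg, hs]
        exact fun z hz => hz p hp
      have := hnonneg _ _ hpC
      rw [hqy, inner_smul_right] at this
      by_contra hcon
      nlinarith
    rw [inner_neg_right, inner_pair, hqy, inner_smul_right] at hwx
    have ha : a = -inner ℝ u y := by
      have : t * (a + inner ℝ u y) = 0 := by linarith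
      rcases mul_eq_zero.1 this with h | h
      · exact absurd h ht.ne'
      · linarith
    have hmin : IsMinOn (fun x => inner ℝ u x) P y := by
      intro z hz
      show inner ℝ u y ≤ inner ℝ u z
      linarith [mem_dualCone_coneOver.1 hwC' z hz]
    have hu0 : u ≠ 0 := by
      rintro rfl
      rw [inner_zero_left, neg_zero] at ha
      exact hw0 (pair_eq_zero.2 ⟨ha, rfl⟩)
    have hcone : coneOf {u} ∈ normalFan P := by
      refine ⟨minFace P u, isFace_minFace ⟨hyP, hmin⟩, Subset.antisymm ?_ ?_⟩
      · intro u' hu'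
        obtain ⟨c, hc, rfl⟩ := mem_coneOf_singleton.1 hu'
        exact fun x hx => isMinOn_smul hc hx.2
      · intro u' hu'
        have hu'' := hu' y ⟨hyP, hmin⟩
        obtain ⟨c, hc, hcw⟩ := hface (-inner ℝ u' y) u' (by
          rw [mem_dualCone_coneOver, neg_neg]
          exact fun z hz => hu'' hz) (by
            rw [hqy, inner_smul_right]
            linarith)
        rw [smul_pair, pair_inj] at hcw
        exact mem_coneOf_singleton.2 ⟨c, hc, hcw.2⟩
    obtain ⟨v, ⟨hv, hvu⟩, -⟩ := hV.2 u hu0 hcone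
    obtain ⟨c, hc, rfl⟩ := (coneOf_singleton_eq_iff hu0).1 hvu
    have hvmin : IsMinOn (fun x => inner ℝ v x) P y := by
      have := isMinOn_smul (inv_nonneg.2 hc.le) hmin
      rwa [inv_smul_smul₀ hc.ne'] at this
    refine ⟨_, mem_dualGenerators.2 (Or.inl ⟨v, hv, rfl⟩), ?_⟩
    rw [coneOf_singleton_eq_iff hw0]
    refine ⟨c, hc, ?_⟩
    rw [smul_pair, ha, supportFn_eq_neg_inner hyP hvmin, real_inner_smul_left, mul_neg]

theorem isRayGenerators_dualGenerators (hP : IsPolyhedron P)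
    (hV : IsRayGenerators (normalFan P) V) :
    IsRayGenerators (faces (dualCone (coneOver P))) (dualGenerators P V) := by
  have hne : ∀ w ∈ dualGenerators P V, w ≠ 0 := by
    intro w hw h
    rcases mem_dualGenerators.1 hw with ⟨v, hv, rfl⟩ | ⟨rfl, -⟩
    · exact (hV.1 v hv).1 (pair_eq_zero.1 h).2
    · exact one_ne_zero (pair_eq_zero.1 h).1
  have huniq : ∀ w₁ ∈ dualGenerators P V, ∀ w₂ ∈ dualGenerators P V,
      coneOf {w₁} = coneOf {w₂} → w₁ = w₂ := by
    intro w₁ h₁ w₂ h₂ h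
    obtain ⟨c, hc, hcw⟩ := (coneOf_singleton_eq_iff (hne _ h₂)).1 h
    rcases mem_dualGenerators.1 h₁ with ⟨v₁, hv₁, rfl⟩ | ⟨rfl, -⟩ <;>
      rcases mem_dualGenerators.1 h₂ with ⟨v₂, hv₂, rfl⟩ | ⟨rfl, -⟩
    · rw [smul_pair, pair_inj] at hcw
      have := (coneOf_singleton_eq_iff (hV.1 v₂ hv₂).1).2 ⟨c, hc, hcw.2⟩
      rw [hV.eq_of_coneOf_eq hv₁ hv₂ this]
    · rw [smul_pair, pair_inj] at hcw
      exact absurd hcw.2.symm (smul_ne_zero hc.ne' (hV.1 v₁ hv₁).1)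
    · rw [smul_pair, pair_inj, smul_zero] at hcw
      exact absurd hcw.2 (hV.1 v₂ hv₂).1
    · rfl
  refine ⟨fun w hw => ⟨hne w hw, ?_⟩, fun w hw0 hw => ?_⟩
  · rcases mem_dualGenerators.1 hw with ⟨v, hv, rfl⟩ | ⟨rfl, h⟩
    · exact coneOf_pair_mem_faces hP hV hv
    · exact h
  · obtain ⟨w', hw', heq⟩ := exists_dualGenerator hP hV hw0 hw
    exact ⟨w', ⟨hw', heq⟩, fun w'' h => huniq _ h.1 _ hw' (h.2.trans heq.symm)⟩

/-! ### Translates -/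

theorem isMinOn_translate {u y z : EuclideanSpace ℝ (Fin d)}
    (h : IsMinOn (fun x => inner ℝ u x) P y) :
    IsMinOn (fun x => inner ℝ u x) (translate P z) (y - z) := by
  rintro _ ⟨x, hx, rfl⟩
  have : inner ℝ u y ≤ inner ℝ u x := h hx
  show inner ℝ u (y - z) ≤ inner ℝ u (x - z)
  rw [inner_sub_right, inner_sub_right]
  linarith

theorem supportFn_translate {u z : EuclideanSpace ℝ (Fin d)} (hu : u ∈ ⋃₀ normalFan P) :
    supportFn (translate P z) u = supportFn P u + inner ℝ u z := by
  obtain ⟨y, hy, hmin⟩ := mem_sUnion_normalFan.1 hu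
  rw [supportFn_eq_neg_inner hy hmin,
    supportFn_eq_neg_inner (P := translate P z) ⟨y, hy, rfl⟩ (isMinOn_translate hmin),
    inner_sub_right]
  ring

theorem IsRayGenerators.subset_sUnion (hV : IsRayGenerators (normalFan P) V)
    {v : EuclideanSpace ℝ (Fin d)} (hv : v ∈ V) : v ∈ ⋃₀ normalFan P :=
  ⟨_, (hV.1 v hv).2, self_mem_coneOf (mem_singleton v)⟩

/-- From an interior point one can still move along `-v`, which strictly decreases `⟨v, ·⟩`; so its
minimum over `P` lies strictly below its value at `z`. -/
theorem supportFn_add_inner_pos {v z : EuclideanSpace ℝ (Fin d)} (hz : z ∈ interior P)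
    (hv0 : v ≠ 0) (hv : v ∈ ⋃₀ normalFan P) : 0 < supportFn P v + inner ℝ v z := by
  obtain ⟨y, hy, hmin⟩ := mem_sUnion_normalFan.1 hv
  have hcont : Continuous fun t : ℝ => z - t • v := by fun_prop
  have hev : ∀ᶠ t in nhds (0 : ℝ), z - t • v ∈ P :=
    hcont.continuousAt (by simpa using mem_interior_iff_mem_nhds.1 hz)
  obtain ⟨ε, hε, hball⟩ := Metric.eventually_nhds_iff.1 hev
  have hmem := hball (y := ε / 2) (by
    rw [dist_zero_right, Real.norm_eq_abs, abs_of_pos (by linarith)]; linarith)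
  have h1 : inner ℝ v y ≤ inner ℝ v (z - (ε / 2) • v) := hmin hmem
  rw [inner_sub_right, inner_smul_right] at h1
  rw [supportFn_eq_neg_inner hy hmin]
  have := mul_pos (half_pos hε) (real_inner_self_pos.2 hv0)
  linarith

/-- The vectors orthogonal to a ray generator are directions of the face which it exposes. -/
theorem vectorSpan_minFace_translate (hP : IsPolyhedron P) {v y : EuclideanSpace ℝ (Fin d)}
    (z : EuclideanSpace ℝ (Fin d)) (hy : y ∈ P) (hyv : normalCone P {y} = coneOf {v}) :
    vectorSpan ℝ (minFace (translate P z) v) = (Submodule.span ℝ {v})ᗮ := by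
  have hmin := isMinOn_of_normalCone_eq hyv
  apply le_antisymm
  · rw [vectorSpan_def, Submodule.span_le]
    rintro _ ⟨x, hx, x', hx', rfl⟩
    rw [SetLike.mem_coe, Submodule.mem_orthogonal_singleton_iff_inner_right]
    show inner ℝ v (x - x') = 0
    rw [inner_sub_right, sub_eq_zero]
    exact le_antisymm (hx.2 hx'.1) (hx'.2 hx.1)
  · intro u hu
    rw [Submodule.mem_orthogonal_singleton_iff_inner_right] at hu
    have hev : ∀ᶠ t in nhds (0 : ℝ), y + t • u ∈ P := by
      obtain ⟨-, s, hs⟩ := hP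
      have hyP := hy
      rw [hs] at hyP
      have : ∀ p ∈ s, ∀ᶠ t in nhds (0 : ℝ), p.2 ≤ inner ℝ p.1 (y + t • u) := by
        intro p hp
        rcases (hyP p hp).eq_or_lt with h | h
        -- The normal of a constraint active at `y` lies in the normal cone there, so it is a
        -- multiple of `v` and is not affected by moving along `u ⊥ v`.
        · have hpN : p.1 ∈ normalCone P {y} := by
            rw [mem_normalCone_singleton]
            intro x hx
            show inner ℝ p.1 y ≤ inner ℝ p.1 x
            rw [← h]
            rw [hs] at hx
            exact hx p hp
          rw [hyv] at hpN
          obtain ⟨c, -, hc⟩ := mem_coneOf_singleton.1 hpN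
          refine Filter.Eventually.of_forall fun t => ?_
          rw [inner_add_right, inner_smul_right, hc, real_inner_smul_left _ u, hu, ← hc, h]
          simp
        · have hcont : Continuous fun t : ℝ => inner ℝ p.1 (y + t • u) := by fun_prop
          exact (hcont.continuousAt.eventually (lt_mem_nhds (by simpa using h))).mono
            fun t ht => le_of_lt ht
      have := (Filter.eventually_all_finset s).2 this
      rw [hs]
      exact this
    obtain ⟨ε, hε, hball⟩ := Metric.eventually_nhds_iff.1 hev
    have hmem := hball (y := ε / 2) (by
      rw [dist_zero_right, Real.norm_eq_abs, abs_of_pos (by linarith)]; linarith)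
    have h1 : y - z ∈ minFace (translate P z) v := ⟨⟨y, hy, rfl⟩, isMinOn_translate hmin⟩
    have h2 : y + (ε / 2) • u - z ∈ minFace (translate P z) v := by
      refine ⟨⟨_, hmem, rfl⟩, isMinOn_translate fun x hx => ?_⟩
      show inner ℝ v (y + (ε / 2) • u) ≤ inner ℝ v x
      rw [inner_add_right, inner_smul_right, hu, mul_zero, add_zero]
      exact hmin hx
    have h3 := vsub_mem_vectorSpan ℝ h2 h1
    rw [vsub_eq_sub, show y + (ε / 2) • u - z - (y - z) = (ε / 2) • u by abel] at h3
    exact (Submodule.smul_mem_iff _ (half_pos hε).ne').1 h3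

/-- The face exposed by `v` has direction space `v^⊥`, so it is a facet. A zero support value would
put the origin on its affine span. -/
theorem supportFn_translate_ne_zero (hP : IsPolyhedron P) (hV : IsRayGenerators (normalFan P) V)
    {z : EuclideanSpace ℝ (Fin d)} (hz : NonCodegenerate (translate P z))
    {v : EuclideanSpace ℝ (Fin d)} (hv : v ∈ V) : supportFn (translate P z) v ≠ 0 := by
  obtain ⟨y, hy, hyv⟩ := hV.exists_normalCone_eq hP.convex hv
  have hspan := vectorSpan_minFace_translate hP z hy hyv
  have hyF : y - z ∈ minFace (translate P z) v :=
    ⟨⟨y, hy, rfl⟩, isMinOn_translate (isMinOn_of_normalCone_eq hyv)⟩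
  intro h0
  rw [supportFn_eq_neg_inner hyF.1 hyF.2, neg_eq_zero] at h0
  refine hz _ (isFace_minFace hyF) ?_ ?_
  · have := Submodule.finrank_add_finrank_orthogonal (Submodule.span ℝ {v})
    rw [finrank_span_singleton (hV.1 v hv).1, finrank_euclideanSpace_fin] at this
    rw [hspan]
    omega
  · have hdir : -(y - z) ∈ (affineSpan ℝ (minFace (translate P z) v)).direction := by
      rw [direction_affineSpan, hspan, Submodule.mem_orthogonal_singleton_iff_inner_right,
        inner_neg_right, h0, neg_zero]
    have := AffineSubspace.vadd_mem_of_mem_direction hdir (subset_affineSpan ℝ _ hyF)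
    simpa using this

end Rays

end DualVolume

namespace DualVolume

open Set MeasureTheory

/-! ### Exponential integrals over simplicial cones -/

section Integral

variable {n d : ℕ}

theorem absDet_nonneg (S : Finset (EuclideanSpace ℝ (Fin n))) : 0 ≤ absDet S := by
  unfold absDet
  split_ifs
  · exact abs_nonneg _
  · exact le_rfl

theorem lintegral_exp_neg_orthant (a : Fin n → ℝ) (ha : ∀ i, 0 < a i) :
    ∫⁻ c in Set.pi univ fun _ : Fin n => Ici (0 : ℝ), ENNReal.ofReal (Real.exp (-∑ i, c i * a i)) =
      ENNReal.ofReal (∏ i, a i)⁻¹ := by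
  have hint : ∀ i, Integrable (fun t : ℝ => Real.exp (-a i * t)) (volume.restrict (Ici 0)) :=
    fun i => (integrableOn_Ici_iff_integrableOn_Ioi).2
      (integrableOn_exp_mul_Ioi (neg_neg_of_pos (ha i)) 0)
  have hval : ∀ i, ∫ t in Ici (0 : ℝ), Real.exp (-a i * t) = (a i)⁻¹ := fun i => by
    rw [integral_Ici_eq_integral_Ioi, integral_exp_mul_Ioi (neg_neg_of_pos (ha i))]
    simp
  have hexp : ∀ c : Fin n → ℝ, Real.exp (-∑ i, c i * a i) = ∏ i, Real.exp (-a i * c i) := fun c => by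
    rw [← Real.exp_sum, ← Finset.sum_neg_distrib]
    exact congrArg _ (Finset.sum_congr rfl fun i _ => by ring)
  have hprod : Integrable (fun c : Fin n → ℝ => ∏ i, Real.exp (-a i * c i))
      (Measure.pi fun _ : Fin n => volume.restrict (Ici (0 : ℝ))) :=
    Integrable.fintype_prod_dep (f := fun i t => Real.exp (-a i * t)) hint
  have hfubini := integral_fintype_prod_eq_prod (𝕜 := ℝ)
    (μ := fun _ : Fin n => volume.restrict (Ici (0 : ℝ))) fun i t => Real.exp (-a i * t)
  simp_rw [hexp]
  rw [volume_pi, Measure.restrict_pi_pi, ← ofReal_integral_eq_lintegral_ofReal hprod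
    (Filter.Eventually.of_forall fun c => Finset.prod_nonneg fun i _ => (Real.exp_pos _).le),
    hfubini, Finset.prod_congr rfl fun i _ => hval i, Finset.prod_inv_distrib]

theorem volume_coneOf_eq_zero {S : Finset (EuclideanSpace ℝ (Fin n))}
    (hS : LinearIndepOn ℝ id (S : Set (EuclideanSpace ℝ (Fin n)))) (hcard : S.card ≠ n) :
    volume (coneOf (S : Set (EuclideanSpace ℝ (Fin n)))) = 0 := by
  have hsub : coneOf (S : Set (EuclideanSpace ℝ (Fin n))) ⊆
      (Submodule.span ℝ (S : Set (EuclideanSpace ℝ (Fin n))) : Set (EuclideanSpace ℝ (Fin n))) := by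
    intro x hx
    obtain ⟨c, -, rfl⟩ := mem_coneOf_finset.1 hx
    exact Submodule.sum_mem _ fun v hv => Submodule.smul_mem _ _ (Submodule.subset_span hv)
  have hrank := finrank_span_finset_eq_card hS
  have hne : Submodule.span ℝ (S : Set (EuclideanSpace ℝ (Fin n))) ≠ ⊤ := by
    intro htop
    rw [htop, finrank_top, finrank_euclideanSpace_fin] at hrank
    exact hcard hrank.symm
  have hnull := Measure.addHaar_submodule (volume : Measure (EuclideanSpace ℝ (Fin n))) _ hne
  exact measure_mono_null hsub hnull

/-- A simplicial cone is the image of a closed orthant under a continuous injective map. -/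
theorem measurableSet_coneOf {S : Finset (EuclideanSpace ℝ (Fin n))}
    (hS : LinearIndepOn ℝ id (S : Set (EuclideanSpace ℝ (Fin n)))) :
    MeasurableSet (coneOf (S : Set (EuclideanSpace ℝ (Fin n)))) := by
  classical
  have himage : coneOf (S : Set (EuclideanSpace ℝ (Fin n))) =
      (fun c : S → ℝ => ∑ v, c v • (v : EuclideanSpace ℝ (Fin n))) ''
        Set.pi univ fun _ => Ici (0 : ℝ) := by
    ext x
    rw [mem_coneOf_finset]
    constructor
    · rintro ⟨c, hc, rfl⟩
      exact ⟨fun v => c v, fun v _ => hc v v.2, Finset.sum_coe_sort S fun v => c v • v⟩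
    · rintro ⟨c, hc, rfl⟩
      refine ⟨fun v => if h : v ∈ S then c ⟨v, h⟩ else 0, fun v hv => ?_, ?_⟩
      · simp only [hv, dif_pos]
        exact hc _ (mem_univ _)
      · rw [← Finset.sum_coe_sort S]
        exact Finset.sum_congr rfl fun v _ => by simp
  rw [himage]
  refine MeasurableSet.image_of_continuousOn_injOn
    (MeasurableSet.univ_pi fun _ => measurableSet_Ici) (by fun_prop) (Function.Injective.injOn ?_)
  have hS' : LinearIndependent ℝ fun v : S => (v : EuclideanSpace ℝ (Fin n)) := hS
  intro c c' h
  have := Fintype.linearIndependent_iff.1 hS' (c - c') (by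
    simp only [Pi.sub_apply, sub_smul, Finset.sum_sub_distrib]
    exact sub_eq_zero.2 h)
  exact funext fun i => sub_eq_zero.1 (this i)

/-- The generators map the orthant linearly onto the cone; the Jacobian is the determinant, and the
integrand becomes a product of one-variable exponentials. -/
theorem lintegral_exp_neg_coneOf {S : Finset (EuclideanSpace ℝ (Fin n))}
    (hS : LinearIndepOn ℝ id (S : Set (EuclideanSpace ℝ (Fin n))))
    (x : EuclideanSpace ℝ (Fin n)) (hx : ∀ v ∈ S, 0 < inner ℝ v x) :
    ∫⁻ u in coneOf (S : Set (EuclideanSpace ℝ (Fin n))), ENNReal.ofReal (Real.exp (-inner ℝ u x)) =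
      ENNReal.ofReal (absDet S / ∏ v ∈ S, inner ℝ v x) := by
  by_cases hcard : S.card = n
  swap
  -- Lower-dimensional cones are null, matching the convention that `absDet` is `0` for them.
  · rw [Measure.restrict_eq_zero.2 (volume_coneOf_eq_zero hS hcard), lintegral_zero_measure,
      absDet, dif_neg hcard, zero_div, ENNReal.ofReal_zero]
  set e := (S.equivFinOfCardEq hcard).symm
  set M : Matrix (Fin n) (Fin n) ℝ :=
    Matrix.of fun i j => ((e i : EuclideanSpace ℝ (Fin n)) j) with hM
  have habs : absDet S = |M.det| := by rw [absDet, dif_pos hcard]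
  set L := Matrix.toLin' M.transpose with hL
  have hLapply : ∀ c : Fin n → ℝ, WithLp.toLp 2 (L c) =
      ∑ i, c i • (e i : EuclideanSpace ℝ (Fin n)) := by
    intro c
    ext j
    simp [hL, hM, Matrix.mulVec, dotProduct, mul_comm]
  have hinj : Function.Injective L := by
    have hS' : LinearIndependent ℝ fun v : S => (v : EuclideanSpace ℝ (Fin n)) := hS
    have hS'' := hS'.comp e e.injective
    intro c c' h
    have := Fintype.linearIndependent_iff.1 hS'' (c - c') (by
      have h' : WithLp.toLp 2 (L (c - c')) = (0 : EuclideanSpace ℝ (Fin n)) := by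
        rw [map_sub, h, sub_self]; rfl
      rw [← h', hLapply]
      rfl)
    exact funext fun i => sub_eq_zero.1 (this i)
  set O := Set.pi univ fun _ : Fin n => Ici (0 : ℝ)
  have hpre : coneOf (S : Set (EuclideanSpace ℝ (Fin n))) = WithLp.ofLp ⁻¹' (L '' O) := by
    ext u
    rw [mem_coneOf_finset]
    constructor
    · rintro ⟨c, hc, rfl⟩
      refine ⟨fun i => c (e i), fun i _ => hc _ (e i).2, ?_⟩
      apply WithLp.toLp_injective 2
      rw [hLapply, WithLp.toLp_ofLp, ← Finset.sum_coe_sort S fun v => c v • v]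
      exact e.sum_comp fun v => c v • (v : EuclideanSpace ℝ (Fin n))
    · rintro ⟨c, hc, hcu⟩
      obtain rfl : u = WithLp.toLp 2 (L c) := by rw [hcu, WithLp.toLp_ofLp]
      refine ⟨fun v => if h : v ∈ S then c (e.symm ⟨v, h⟩) else 0, fun v hv => ?_, ?_⟩
      · simp only [hv, dif_pos]
        exact hc _ (mem_univ _)
      · rw [hLapply, ← Finset.sum_coe_sort S, ← e.sum_comp]
        exact Finset.sum_congr rfl fun i _ => by simp
  have hstep : ∫⁻ u in coneOf (S : Set (EuclideanSpace ℝ (Fin n))),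
      ENNReal.ofReal (Real.exp (-inner ℝ u x)) =
      ∫⁻ y in L '' O, ENNReal.ofReal (Real.exp (-inner ℝ (WithLp.toLp 2 y) x)) := by
    rw [hpre]
    exact (EuclideanSpace.volume_preserving_symm_measurableEquiv_toLp
      (Fin n)).setLIntegral_comp_preimage_emb (MeasurableEquiv.measurableEmbedding _)
        (fun y => ENNReal.ofReal (Real.exp (-inner ℝ (WithLp.toLp 2 y) x))) (L '' O)
  have hOm : MeasurableSet O := MeasurableSet.univ_pi fun _ => measurableSet_Ici
  rw [hstep, lintegral_image_eq_lintegral_abs_det_fderiv_mul volume hOm (f := ⇑L)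
    (f' := fun _ => LinearMap.toContinuousLinearMap L)
    (fun c _ => (LinearMap.toContinuousLinearMap L).hasFDerivAt.hasFDerivWithinAt) hinj.injOn]
  have hdet : (LinearMap.toContinuousLinearMap L).det = M.det := by
    rw [LinearMap.det_toContinuousLinearMap, hL, LinearMap.det_toLin', Matrix.det_transpose]
  have hinner : ∀ c : Fin n → ℝ, inner ℝ (WithLp.toLp 2 (L c)) x =
      ∑ i, c i * inner ℝ (e i : EuclideanSpace ℝ (Fin n)) x := by
    intro c
    rw [hLapply, sum_inner]
    exact Finset.sum_congr rfl fun i _ => real_inner_smul_left _ _ _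
  simp_rw [hdet, hinner]
  rw [lintegral_const_mul' _ _ ENNReal.ofReal_ne_top,
    lintegral_exp_neg_orthant _ fun i => hx _ (e i).2, ← ENNReal.ofReal_mul (abs_nonneg _), habs,
    div_eq_mul_inv, ← Finset.prod_coe_sort S fun v => inner ℝ v x,
    e.prod_comp fun v => inner ℝ (v : EuclideanSpace ℝ (Fin n)) x]

/-! ### Triangulations up to null sets -/

/-- A face containing the origin lies in the orthogonal complement of its exposing vector, which is
null unless that vector is `0`. -/
theorem IsFace.eq_or_volume_eq_zero {C F : Set (EuclideanSpace ℝ (Fin n))} (h : IsFace C F)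
    (h0 : 0 ∈ F) : F = C ∨ volume F = 0 := by
  obtain ⟨-, hFC, y, b, h1, h2⟩ := h
  obtain rfl : b = 0 := by rw [← h1 0 h0, inner_zero_left]
  by_cases hy : y = 0
  · left
    refine hFC.antisymm fun x hx => ?_
    by_contra hxF
    have := h2 x ⟨hx, hxF⟩
    simp [hy] at this
  · right
    refine measure_mono_null (t := ((Submodule.span ℝ {y})ᗮ : Submodule ℝ _)) (fun x hx => ?_)
      (Measure.addHaar_submodule volume _ fun htop => hy ?_)
    · rw [SetLike.mem_coe, Submodule.mem_orthogonal_singleton_iff_inner_left]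
      exact h1 x hx
    · have : y ∈ (Submodule.span ℝ {y})ᗮ := htop ▸ Submodule.mem_top
      rw [Submodule.mem_orthogonal_singleton_iff_inner_left] at this
      exact inner_self_eq_zero.1 this

/-- Every generator of a simplicial cone generates an extreme ray of it. -/
theorem exists_coneOf_eq_of_coneOf_eq {S S' : Finset (EuclideanSpace ℝ (Fin n))}
    (hS : LinearIndepOn ℝ id (S : Set (EuclideanSpace ℝ (Fin n))))
    (h : coneOf (S : Set (EuclideanSpace ℝ (Fin n))) = coneOf S')
    {v : EuclideanSpace ℝ (Fin n)} (hv : v ∈ S) (hS'0 : ∀ u ∈ S', u ≠ 0) :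
    ∃ u ∈ S', coneOf {v} = coneOf {u} := by
  have hv0 : v ≠ 0 := hS.ne_zero (i := v) hv
  obtain ⟨c, hc, hvc⟩ := mem_coneOf_finset.1 (h ▸ self_mem_coneOf (Finset.mem_coe.2 hv))
  have hmem : ∀ u ∈ S', ∃ a : EuclideanSpace ℝ (Fin n) → ℝ, (∀ w ∈ S, 0 ≤ a w) ∧
      u = ∑ w ∈ S, a w • w := fun u hu =>
    mem_coneOf_finset.1 (h.symm ▸ self_mem_coneOf (Finset.mem_coe.2 hu))
  choose! a ha hua using hmem
  obtain ⟨u, hu, hcu⟩ : ∃ u ∈ S', c u ≠ 0 := by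
    by_contra hcon
    push Not at hcon
    exact hv0 (by rw [hvc]; exact Finset.sum_eq_zero fun u hu => by rw [hcon u hu, zero_smul])
  -- Expand `v` in `S'` and then each element of `S'` in `S`. By independence the coefficient of `w
  -- ≠ v` vanishes; it is a sum of nonnegative terms, so each term vanishes.
  have hcoef : ∀ w ∈ S, w ≠ v → ∑ u ∈ S', c u * a u w = 0 := by
    classical
    intro w hw hwv
    have hli := linearIndepOn_finset_iff.1 hS
      (fun w => (∑ u ∈ S', c u * a u w) - if w = v then 1 else 0) (by
        simp only [id, sub_smul, Finset.sum_sub_distrib, ite_smul, one_smul, zero_smul,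
          Finset.sum_ite_eq', hv, if_true, Finset.sum_smul, mul_smul]
        rw [Finset.sum_comm, sub_eq_zero]
        conv_rhs => rw [hvc]
        exact Finset.sum_congr rfl fun u hu => by rw [← Finset.smul_sum, ← hua u hu])
    simpa [hwv] using hli w hw
  have hau : u = a u v • v := by
    conv_lhs => rw [hua u hu]
    refine Finset.sum_eq_single_of_mem v hv fun w hw hwv => ?_
    have := (Finset.sum_eq_zero_iff_of_nonneg fun u hu =>
      mul_nonneg (hc u hu) (ha u hu w hw)).1 (hcoef w hw hwv) u hu
    rw [(mul_eq_zero.1 this).resolve_left hcu, zero_smul]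
  refine ⟨u, hu, (coneOf_singleton_eq_iff (hS'0 u hu)).2 ⟨a u v, ?_, hau⟩⟩
  refine lt_of_le_of_ne (ha u hu v hv) fun h0 => hS'0 u hu ?_
  rw [hau, ← h0, zero_smul]

theorem IsTriangulation.eq_of_coneOf_eq {𝓕 : Set (Set (EuclideanSpace ℝ (Fin n)))}
    {V : Finset (EuclideanSpace ℝ (Fin n))} {T : Finset (Finset (EuclideanSpace ℝ (Fin n)))}
    (hV : IsRayGenerators 𝓕 V) (hT : IsTriangulation 𝓕 V T)
    {S S' : Finset (EuclideanSpace ℝ (Fin n))} (hS : S ∈ T) (hS' : S' ∈ T)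
    (h : coneOf (S : Set (EuclideanSpace ℝ (Fin n))) = coneOf S') : S = S' := by
  have key : ∀ S₁ ∈ T, ∀ S₂ ∈ T, coneOf (S₁ : Set (EuclideanSpace ℝ (Fin n))) = coneOf S₂ →
      S₁ ⊆ S₂ := by
    intro S₁ h₁ S₂ h₂ h v hv
    obtain ⟨u, hu, hvu⟩ := exists_coneOf_eq_of_coneOf_eq (hT.simplicial S₁ h₁) h hv
      fun u hu => (hV.1 u (hT.generators S₂ h₂ hu)).1
    rwa [hV.eq_of_coneOf_eq (hT.generators S₁ h₁ hv) (hT.generators S₂ h₂ hu) hvu]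
  exact (key S hS S' hS' h).antisymm (key S' hS' S hS h.symm)

/-- Two cones meet in a common face. If that face is not null it is all of both cones, and then
their generator sets coincide. -/
theorem IsTriangulation.lintegral_eq_sum {𝓕 : Set (Set (EuclideanSpace ℝ (Fin n)))}
    {V : Finset (EuclideanSpace ℝ (Fin n))} {T : Finset (Finset (EuclideanSpace ℝ (Fin n)))}
    (hV : IsRayGenerators 𝓕 V) (hT : IsTriangulation 𝓕 V T)
    (g : EuclideanSpace ℝ (Fin n) → ENNReal) :
    ∫⁻ u in ⋃₀ 𝓕, g u = ∑ S ∈ T, ∫⁻ u in coneOf (S : Set (EuclideanSpace ℝ (Fin n))), g u := by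
  rw [← hT.covers]
  refine lintegral_biUnion_finset₀ (fun S hS S' hS' hne => ?_)
    (fun S hS => (measurableSet_coneOf (hT.simplicial S hS)).nullMeasurableSet) g
  show volume (coneOf (S : Set (EuclideanSpace ℝ (Fin n))) ∩ coneOf S') = 0
  have h0 : (0 : EuclideanSpace ℝ (Fin n)) ∈ coneOf (S : Set (EuclideanSpace ℝ (Fin n))) ∩
    coneOf S' := ⟨zero_mem_coneOf _, zero_mem_coneOf _⟩
  rcases (hT.inter_face S hS S' hS').eq_or_volume_eq_zero h0 with h | h
  · rcases (hT.inter_face S' hS' S hS).eq_or_volume_eq_zero h0.symm with h' | h'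
    · exact absurd (hT.eq_of_coneOf_eq hV hS hS' (by rw [← h, inter_comm, h'])) hne
    · rwa [inter_comm]
  · exact h

theorem IsTriangulation.measurableSet_sUnion {𝓕 : Set (Set (EuclideanSpace ℝ (Fin n)))}
    {V : Finset (EuclideanSpace ℝ (Fin n))} {T : Finset (Finset (EuclideanSpace ℝ (Fin n)))}
    (hT : IsTriangulation 𝓕 V T) : MeasurableSet (⋃₀ 𝓕) := by
  rw [← hT.covers]
  exact T.measurableSet_biUnion fun S hS => measurableSet_coneOf (hT.simplicial S hS)

theorem sUnion_faces {C : Set (EuclideanSpace ℝ (Fin n))} (hC : C.Nonempty) :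
    ⋃₀ faces C = C := by
  refine Subset.antisymm (sUnion_subset fun F hF => hF.2.1) (subset_sUnion_of_mem ?_)
  exact ⟨hC, Subset.rfl, 0, 0, fun x _ => inner_zero_right _, fun x hx => absurd hx.1 hx.2⟩

/-! ### Integration over the dual cone -/

theorem lintegral_exp_neg_Ici (c k : ℝ) :
    ∫⁻ a in Ici c, ENNReal.ofReal (Real.exp (-(a + k))) = ENNReal.ofReal (Real.exp (-(c + k))) := by
  have hexp : ∀ a : ℝ, Real.exp (-(a + k)) = Real.exp (-1 * a) * Real.exp (-k) := fun a => by
    rw [← Real.exp_add]; ring_nf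
  have hint : Integrable (fun a : ℝ => Real.exp (-1 * a)) (volume.restrict (Ici c)) :=
    (integrableOn_Ici_iff_integrableOn_Ioi).2 (integrableOn_exp_mul_Ioi (by norm_num) c)
  simp_rw [hexp]
  rw [← ofReal_integral_eq_lintegral_ofReal (hint.mul_const _)
    (Filter.Eventually.of_forall fun a => by positivity), integral_mul_const,
    integral_Ici_eq_integral_Ioi, integral_exp_mul_Ioi (by norm_num)]
  simp

theorem measurePreserving_pair :
    MeasurePreserving (fun p : ℝ × EuclideanSpace ℝ (Fin d) => pair p.1 p.2) := by
  have h1 := (MeasurePreserving.id (volume : Measure ℝ)).prod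
    (EuclideanSpace.volume_preserving_symm_measurableEquiv_toLp (Fin d))
  have h2 := (volume_preserving_piFinSuccAbove (fun _ : Fin (d + 1) => ℝ) 0).symm
  have h3 := PiLp.volume_preserving_toLp (Fin (d + 1))
  convert! h3.comp (h2.comp h1) using 1
  ext p i
  refine Fin.cases ?_ (fun i => ?_) i <;> simp [MeasurableEquiv.piFinSuccAbove]

theorem isClosed_dualCone (C : Set (EuclideanSpace ℝ (Fin n))) : IsClosed (dualCone C) := by
  have : dualCone C = ⋂ y ∈ C, {v | 0 ≤ inner ℝ v y} := by
    ext; simp [dualCone]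
  rw [this]
  exact isClosed_biInter fun y _ => isClosed_le continuous_const (by fun_prop)

/-- Tonelli in the height coordinate: the fibre over `u` is `[h_P(u), ∞)` for `u` in the support of
the normal fan and empty otherwise. -/
theorem lintegral_dualCone_coneOver {P : Set (EuclideanSpace ℝ (Fin d))} (hP : IsPolyhedron P)
    (hm : MeasurableSet (⋃₀ normalFan P)) (z : EuclideanSpace ℝ (Fin d)) :
    ∫⁻ w in dualCone (coneOver P), ENNReal.ofReal (Real.exp (-inner ℝ w (pair 1 z))) =
      ∫⁻ u in ⋃₀ normalFan P, ENNReal.ofReal (Real.exp (-(supportFn P u + inner ℝ u z))) := by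
  have hC := (isClosed_dualCone (coneOver P)).measurableSet
  have hmeas : Measurable ((dualCone (coneOver P)).indicator
      fun w => ENNReal.ofReal (Real.exp (-inner ℝ w (pair 1 z)))) :=
    Measurable.indicator (by fun_prop) hC
  have hmeas' : Measurable fun p : ℝ × EuclideanSpace ℝ (Fin d) =>
      (dualCone (coneOver P)).indicator
        (fun w => ENNReal.ofReal (Real.exp (-inner ℝ w (pair 1 z)))) (pair p.1 p.2) :=
    hmeas.comp measurePreserving_pair.measurable
  rw [← lintegral_indicator hC, ← lintegral_indicator hm,
    ← measurePreserving_pair.lintegral_comp hmeas, Measure.volume_eq_prod,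
    lintegral_prod_symm' _ hmeas']
  refine lintegral_congr fun u => ?_
  by_cases hu : u ∈ ⋃₀ normalFan P
  · rw [indicator_of_mem hu, ← lintegral_exp_neg_Ici, ← lintegral_indicator measurableSet_Ici]
    refine lintegral_congr fun a => ?_
    by_cases ha : supportFn P u ≤ a
    · rw [indicator_of_mem ((hP.mem_dualCone_coneOver_iff).2 ⟨hu, ha⟩),
        indicator_of_mem (mem_Ici.2 ha), inner_pair, mul_one]
    · rw [indicator_of_notMem fun h => ha ((hP.mem_dualCone_coneOver_iff).1 h).2,
        indicator_of_notMem fun h => ha (mem_Ici.1 h)]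
  · rw [indicator_of_notMem hu]
    refine (lintegral_congr fun a => ?_).trans lintegral_zero
    exact indicator_of_notMem (fun h => hu ((hP.mem_dualCone_coneOver_iff).1 h).1) _

end Integral

end DualVolume

namespace DualVolume

open Set MeasureTheory

/-! ### Comparison of the two triangulations -/

section Comparison

variable {d : ℕ} {P : Set (EuclideanSpace ℝ (Fin d))} {V : Finset (EuclideanSpace ℝ (Fin d))}
  {T : Finset (Finset (EuclideanSpace ℝ (Fin d)))}
  {T' : Finset (Finset (EuclideanSpace ℝ (Fin (d + 1))))}

theorem sum_mul_prod_sdiff_div {K E : Type*} [Field K] [DecidableEq E] {V : Finset E}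
    {T : Finset (Finset E)} (hT : ∀ S ∈ T, S ⊆ V) (a : Finset E → K) {f : E → K}
    (hf : ∀ v ∈ V, f v ≠ 0) :
    (∑ S ∈ T, a S * ∏ v ∈ V \ S, f v) / ∏ v ∈ V, f v = ∑ S ∈ T, a S / ∏ v ∈ S, f v := by
  rw [Finset.sum_div]
  refine Finset.sum_congr rfl fun S hS => ?_
  have h1 : ∏ v ∈ V \ S, f v ≠ 0 :=
    Finset.prod_ne_zero_iff.2 fun v hv => hf v (Finset.sdiff_subset hv)
  rw [← Finset.prod_sdiff (hT S hS), mul_comm (a S), mul_div_mul_left _ _ h1]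

/-- The cone lies in the normal cone of a face; for any `y` in that face, `h_P(u) = -⟨u, y⟩`
throughout, so the exponent is the linear form paired with `z - y`. -/
theorem lintegral_exp_neg_normalFan (hV : IsRayGenerators (normalFan P) V)
    (hT : IsTriangulation (normalFan P) V T) {z : EuclideanSpace ℝ (Fin d)}
    (hz : z ∈ interior P) {S : Finset (EuclideanSpace ℝ (Fin d))} (hS : S ∈ T) :
    ∫⁻ u in coneOf (S : Set (EuclideanSpace ℝ (Fin d))),
        ENNReal.ofReal (Real.exp (-(supportFn P u + inner ℝ u z))) =
      ENNReal.ofReal (absDet S / ∏ v ∈ S, (supportFn P v + inner ℝ v z)) := by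
  obtain ⟨_, ⟨F, hF, rfl⟩, hSF⟩ := hT.refines S hS
  obtain ⟨y, hy⟩ := hF.1
  have hlin : ∀ u ∈ coneOf (S : Set (EuclideanSpace ℝ (Fin d))),
      supportFn P u + inner ℝ u z = inner ℝ u (z - y) := by
    intro u hu
    rw [supportFn_eq_neg_inner (hF.2.1 hy) (hSF hu y hy), inner_sub_right]
    ring
  have hgen : ∀ v ∈ S, supportFn P v + inner ℝ v z = inner ℝ v (z - y) := fun v hv =>
    hlin v (self_mem_coneOf (Finset.mem_coe.2 hv))
  rw [setLIntegral_congr_fun (measurableSet_coneOf (hT.simplicial S hS))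
    (g := fun u => ENNReal.ofReal (Real.exp (-inner ℝ u (z - y)))) fun u hu => by
      simp only [hlin u hu],
    lintegral_exp_neg_coneOf (hT.simplicial S hS), Finset.prod_congr rfl hgen]
  intro v hv
  rw [← hgen v hv]
  have hvV := hT.generators S hS hv
  exact supportFn_add_inner_pos hz (hV.1 v hvV).1 (hV.subset_sUnion hvV)

theorem inner_dualGenerator_pos (hV : IsRayGenerators (normalFan P) V)
    {z : EuclideanSpace ℝ (Fin d)} (hz : z ∈ interior P) {w : EuclideanSpace ℝ (Fin (d + 1))}
    (hw : w ∈ dualGenerators P V) : 0 < inner ℝ w (pair 1 z) := by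
  rcases mem_dualGenerators.1 hw with ⟨v, hv, rfl⟩ | ⟨rfl, -⟩
  · rw [inner_pair, mul_one]
    exact supportFn_add_inner_pos hz (hV.1 v hv).1 (hV.subset_sUnion hv)
  · simp [inner_pair]

/-- Both sides evaluate the same exponential integral over the dual cone. Positivity of all
denominators allows the return from extended nonnegative reals to `ℝ`. -/
theorem sum_absDet_div_eq (hP : IsPolyhedron P) (hV : IsRayGenerators (normalFan P) V)
    (hT : IsTriangulation (normalFan P) V T)
    (hT' : IsTriangulation (faces (dualCone (coneOver P))) (dualGenerators P V) T')
    {z : EuclideanSpace ℝ (Fin d)} (hz : z ∈ interior P) :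
    ∑ F ∈ T', absDet F / ∏ w ∈ F, inner ℝ w (pair 1 z) =
      ∑ S ∈ T, absDet S / ∏ v ∈ S, (supportFn P v + inner ℝ v z) := by
  have h0 : (0 : EuclideanSpace ℝ (Fin (d + 1))) ∈ dualCone (coneOver P) := fun y _ => by simp
  have hpos : ∀ F ∈ T', ∀ w ∈ F, 0 < inner ℝ w (pair 1 z) := fun F hF w hw =>
    inner_dualGenerator_pos hV hz (hT'.generators F hF hw)
  have hpos' : ∀ S ∈ T, ∀ v ∈ S, 0 < supportFn P v + inner ℝ v z := fun S hS v hv =>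
    supportFn_add_inner_pos hz (hV.1 v (hT.generators S hS hv)).1
      (hV.subset_sUnion (hT.generators S hS hv))
  have key := lintegral_dualCone_coneOver hP hT.measurableSet_sUnion z
  rw [hT.lintegral_eq_sum hV, ← sUnion_faces ⟨0, h0⟩,
    hT'.lintegral_eq_sum (isRayGenerators_dualGenerators hP hV),
    Finset.sum_congr rfl fun F hF => lintegral_exp_neg_coneOf (hT'.simplicial F hF) _ (hpos F hF),
    Finset.sum_congr rfl fun S hS => lintegral_exp_neg_normalFan hV hT hz hS] at key
  have hn' : ∀ F ∈ T', 0 ≤ absDet F / ∏ w ∈ F, inner ℝ w (pair 1 z) := fun F hF =>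
    div_nonneg (absDet_nonneg F) (Finset.prod_nonneg fun w hw => (hpos F hF w hw).le)
  have hn : ∀ S ∈ T, 0 ≤ absDet S / ∏ v ∈ S, (supportFn P v + inner ℝ v z) := fun S hS =>
    div_nonneg (absDet_nonneg S) (Finset.prod_nonneg fun v hv => (hpos' S hS v hv).le)
  rw [← ENNReal.ofReal_sum_of_nonneg hn', ← ENNReal.ofReal_sum_of_nonneg hn] at key
  exact (ENNReal.ofReal_eq_ofReal_iff (Finset.sum_nonneg hn') (Finset.sum_nonneg hn)).1 key

/-! ### From values at interior points to polynomial identities -/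

theorem eval_linForm {n : ℕ} (v x : EuclideanSpace ℝ (Fin n)) :
    MvPolynomial.eval (fun i => x i) (linForm v) = inner ℝ v x := by
  simp [linForm, PiLp.inner_apply, mul_comm]

theorem eval_supportPoly (v z : EuclideanSpace ℝ (Fin d)) :
    MvPolynomial.eval (fun i => z i) (supportPoly P v) = supportFn P v + inner ℝ v z := by
  rw [supportPoly, map_add, MvPolynomial.eval_C, eval_linForm]

theorem eval_aeval_cons (z : EuclideanSpace ℝ (Fin d)) (p : MvPolynomial (Fin (d + 1)) ℝ) :
    MvPolynomial.eval (fun i => z i) (MvPolynomial.aeval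
      (Fin.cons 1 MvPolynomial.X : Fin (d + 1) → MvPolynomial (Fin d) ℝ) p) =
      MvPolynomial.eval (fun i => pair 1 z i) p := by
  induction p using MvPolynomial.induction_on with
  | C a => simp
  | add p q hp hq => rw [map_add, map_add, map_add, hp, hq]
  | mul_X p i hp =>
    rw [map_mul, map_mul, map_mul, hp, MvPolynomial.aeval_X, MvPolynomial.eval_X]
    congr 1
    refine Fin.cases ?_ (fun i => ?_) i <;> simp

theorem eval_adjointPoly_eq_eval_numeratorPoly (hP : IsPolyhedron P)
    (hV : IsRayGenerators (normalFan P) V) (hT : IsTriangulation (normalFan P) V T)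
    (hT' : IsTriangulation (faces (dualCone (coneOver P))) (dualGenerators P V) T')
    {z : EuclideanSpace ℝ (Fin d)} (hz : z ∈ interior P) :
    MvPolynomial.eval (fun i => pair 1 z i) (adjointPoly (dualGenerators P V) T') =
      MvPolynomial.eval (fun i => z i) (numeratorPoly P V T) := by
  classical
  have hposV : ∀ v ∈ V, 0 < supportFn P v + inner ℝ v z := fun v hv =>
    supportFn_add_inner_pos hz (hV.1 v hv).1 (hV.subset_sUnion hv)
  have hposW := fun w hw => inner_dualGenerator_pos (P := P) (V := V) hV hz (w := w) hw
  have hprod : ∏ w ∈ dualGenerators P V, inner ℝ w (pair 1 z) =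
      ∏ v ∈ V, (supportFn P v + inner ℝ v z) := by
    have himage : ∏ w ∈ V.image (fun v => pair (supportFn P v) v), inner ℝ w (pair 1 z) =
        ∏ v ∈ V, (supportFn P v + inner ℝ v z) := by
      rw [Finset.prod_image fun v _ v' _ h => (pair_inj.1 h).2]
      exact Finset.prod_congr rfl fun v _ => by rw [inner_pair, mul_one]
    rw [← himage]
    -- The only possible extra factor comes from `(1, 0)`, and it equals `1`.
    refine (Finset.prod_subset (fun w hw => ?_) fun w hw hw' => ?_).symm
    · obtain ⟨v, hv, rfl⟩ := Finset.mem_image.1 hw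
      exact mem_dualGenerators.2 (Or.inl ⟨v, hv, rfl⟩)
    · rcases mem_dualGenerators.1 hw with ⟨v, hv, rfl⟩ | ⟨rfl, -⟩
      · exact absurd (Finset.mem_image.2 ⟨v, hv, rfl⟩) hw'
      · simp [inner_pair]
  have key := sum_absDet_div_eq hP hV hT hT' hz
  rw [← sum_mul_prod_sdiff_div hT'.generators _ fun w hw => (hposW w hw).ne',
    ← sum_mul_prod_sdiff_div hT.generators _ fun v hv => (hposV v hv).ne', hprod,
    div_left_inj' (Finset.prod_ne_zero_iff.2 fun v hv => (hposV v hv).ne')] at key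
  simp only [adjointPoly, numeratorPoly, map_sum, map_mul, map_prod, MvPolynomial.eval_C,
    eval_linForm, eval_supportPoly]
  convert! key

/-- An open set contains a box, a product of infinite sets, and a real polynomial is determined by
its values on such a product. -/
theorem eq_of_eval_eq_on_interior (hfull : (interior P).Nonempty)
    {p q : MvPolynomial (Fin d) ℝ}
    (h : ∀ z ∈ interior P, MvPolynomial.eval (fun i => z i) p = MvPolynomial.eval (fun i => z i) q) :
    p = q := by
  obtain ⟨z, hz⟩ := hfull
  have hopen : IsOpen {x : Fin d → ℝ | WithLp.toLp 2 x ∈ interior P} :=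
    isOpen_interior.preimage (PiLp.continuous_toLp 2 _)
  obtain ⟨ε, hε, hball⟩ := Metric.isOpen_iff.1 hopen (WithLp.ofLp z) hz
  refine MvPolynomial.funext_set (fun i => Metric.ball (z i) ε)
    (fun i => infinite_of_mem_nhds (z i) (Metric.ball_mem_nhds _ hε)) fun x hx => ?_
  exact h (WithLp.toLp 2 x) (hball (by rwa [ball_pi _ hε]))

theorem aeval_adjointPoly_eq_numeratorPoly (hP : IsPolyhedron P) (hfull : (interior P).Nonempty)
    (hV : IsRayGenerators (normalFan P) V) (hT : IsTriangulation (normalFan P) V T)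
    (hT' : IsTriangulation (faces (dualCone (coneOver P))) (dualGenerators P V) T') :
    MvPolynomial.aeval (Fin.cons 1 MvPolynomial.X : Fin (d + 1) → MvPolynomial (Fin d) ℝ)
      (adjointPoly (dualGenerators P V) T') = numeratorPoly P V T :=
  eq_of_eval_eq_on_interior hfull fun z hz => by
    rw [eval_aeval_cons, eval_adjointPoly_eq_eval_numeratorPoly hP hV hT hT' hz]

theorem eval_numeratorPoly (hV : IsRayGenerators (normalFan P) V)
    (z : EuclideanSpace ℝ (Fin d)) :
    MvPolynomial.eval (fun i => z i) (numeratorPoly P V T) = numerator P V T z := by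
  simp only [numeratorPoly, numerator, map_sum, map_mul, map_prod, MvPolynomial.eval_C,
    eval_supportPoly]
  refine Finset.sum_congr rfl fun S _ => congrArg _ (Finset.prod_congr rfl fun v hv => ?_)
  rw [supportFn_translate (hV.subset_sUnion (Finset.mem_sdiff.1 hv).1)]

theorem dualVolumeFun_eq (hfull : (interior P).Nonempty)
    (hV : IsRayGenerators (normalFan P) V) (hT : IsTriangulation (normalFan P) V T) :
    dualVolumeFun P T =
      algebraMap (MvPolynomial (Fin d) ℝ) (FractionRing (MvPolynomial (Fin d) ℝ))
          (numeratorPoly P V T) /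
        algebraMap (MvPolynomial (Fin d) ℝ) (FractionRing (MvPolynomial (Fin d) ℝ))
          (denominatorPoly P V) := by
  obtain ⟨z, hz⟩ := hfull
  have hne : ∀ v ∈ V, algebraMap (MvPolynomial (Fin d) ℝ)
      (FractionRing (MvPolynomial (Fin d) ℝ)) (supportPoly P v) ≠ 0 := by
    -- A support polynomial is not zero because its value at an interior point of `P` is positive.
    intro v hv h
    rw [FaithfulSMul.algebraMap_eq_zero_iff] at h
    have := supportFn_add_inner_pos hz (hV.1 v hv).1 (hV.subset_sUnion hv)
    rw [← eval_supportPoly, h, map_zero] at this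
    exact this.false
  simp only [numeratorPoly, denominatorPoly, map_sum, map_mul, map_prod]
  rw [sum_mul_prod_sdiff_div hT.generators _ hne, dualVolumeFun]

theorem dualVolume_translate_eq (hP : IsPolyhedron P) (hV : IsRayGenerators (normalFan P) V)
    (hT : IsTriangulation (normalFan P) V T) {z : EuclideanSpace ℝ (Fin d)}
    (hz : NonCodegenerate (translate P z)) :
    dualVolume (translate P z) T = numerator P V T z / denominator P V z := by
  rw [numerator, denominator, sum_mul_prod_sdiff_div hT.generators _ fun v hv =>
    supportFn_translate_ne_zero hP hV hz hv, dualVolume]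

end Comparison

end DualVolume

theorem mainTheorem6 {d : ℕ} (P : Set (EuclideanSpace ℝ (Fin d)))
    (hP : DualVolume.IsPolyhedron P) (hfull : (interior P).Nonempty)
    (V : Finset (EuclideanSpace ℝ (Fin d)))
    (hV : DualVolume.IsRayGenerators (DualVolume.normalFan P) V) :
    DualVolume.IsRayGenerators
        (DualVolume.faces (DualVolume.dualCone (DualVolume.coneOver P)))
        (DualVolume.dualGenerators P V) ∧
      ∀ (T : Finset (Finset (EuclideanSpace ℝ (Fin d))))
        (T' : Finset (Finset (EuclideanSpace ℝ (Fin (d + 1))))),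
        DualVolume.IsTriangulation (DualVolume.normalFan P) V T →
        DualVolume.IsTriangulation
          (DualVolume.faces (DualVolume.dualCone (DualVolume.coneOver P)))
          (DualVolume.dualGenerators P V) T' →
        -- the identities of rational functions and of polynomials in `z₁, …, z_d`
        DualVolume.dualVolumeFun P T =
            algebraMap (MvPolynomial (Fin d) ℝ) (FractionRing (MvPolynomial (Fin d) ℝ))
                (MvPolynomial.aeval
                  (Fin.cons 1 MvPolynomial.X : Fin (d + 1) → MvPolynomial (Fin d) ℝ)
                  (DualVolume.adjointPoly (DualVolume.dualGenerators P V) T')) /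
              algebraMap (MvPolynomial (Fin d) ℝ) (FractionRing (MvPolynomial (Fin d) ℝ))
                (DualVolume.denominatorPoly P V) ∧
          MvPolynomial.aeval
              (Fin.cons 1 MvPolynomial.X : Fin (d + 1) → MvPolynomial (Fin d) ℝ)
              (DualVolume.adjointPoly (DualVolume.dualGenerators P V) T') =
            DualVolume.numeratorPoly P V T ∧
        -- the same identities at every vector `z`
          (∀ z : EuclideanSpace ℝ (Fin d),
            MvPolynomial.eval (fun i => DualVolume.pair 1 z i)
                (DualVolume.adjointPoly (DualVolume.dualGenerators P V) T') =
              DualVolume.numerator P V T z) ∧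
          ∀ z : EuclideanSpace ℝ (Fin d),
            DualVolume.NonCodegenerate (DualVolume.translate P z) →
              DualVolume.denominator P V z ≠ 0 ∧
              DualVolume.dualVolume (DualVolume.translate P z) T =
                MvPolynomial.eval (fun i => DualVolume.pair 1 z i)
                    (DualVolume.adjointPoly (DualVolume.dualGenerators P V) T') /
                  DualVolume.denominator P V z := by
  refine ⟨DualVolume.isRayGenerators_dualGenerators hP hV, fun T T' hT hT' => ?_⟩
  have hadj := DualVolume.aeval_adjointPoly_eq_numeratorPoly hP hfull hV hT hT'
  -- Evaluating the polynomial identity removes the restriction to interior points, so zeros of the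
  -- denominator do no harm.
  have heval : ∀ z : EuclideanSpace ℝ (Fin d),
      MvPolynomial.eval (fun i => DualVolume.pair 1 z i)
        (DualVolume.adjointPoly (DualVolume.dualGenerators P V) T') =
      DualVolume.numerator P V T z := fun z => by
    rw [← DualVolume.eval_numeratorPoly hV, ← hadj, DualVolume.eval_aeval_cons]
  refine ⟨?_, hadj, heval, fun z hz => ⟨?_, ?_⟩⟩
  · rw [hadj]
    exact DualVolume.dualVolumeFun_eq hfull hV hT
  · exact Finset.prod_ne_zero_iff.2 fun v hv =>
      DualVolume.supportFn_translate_ne_zero hP hV hz hv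
  · rw [heval]
    exact DualVolume.dualVolume_translate_eq hP hV hT hz
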